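/- Let $\mathcal X\subset\mathbb R^d$ be compact, let $\alpha,\beta$ be probability measures on $\mathcal X$, let $C\colon\mathcal X\times\mathcal X\to\mathbb R$ be Lipschitz, and let $\epsilon>0$. Let $(f^*,g^*)$ be a pair of optimal potentials: continuous functions maximising $\int f\,d\alpha+\int g\,d\beta-\epsilon\int e^{(f(x)+g(y)-C(x,y))/\epsilon}\,d\alpha(x)\,d\beta(y)$, extended to all of $\mathcal X$ by the optimality relations $f^*=-\epsilon\log\int e^{(g^*(y)-C(\cdot,y))/\epsilon}d\beta(y)$ and $g^*=-\epsilon\log\int e^{(f^*(x)-C(x,\cdot))/\epsilon}d\alpha(x)$. Let $-1<b<-\tfrac12$, $a-b>1$, $\zeta>0$, and put $\eta_t=(t+s)^b$, $b_t=(t+s)^{2a}$ (rounded up to an integer), where the integer $s\ge 0$ fixes the numbering ($s=0$: $\eta_t=t^b$, $b_t=t^{2a}$; $s=1$: $\eta_t=(t+1)^b$, $b_t=(t+1)^{2a}$), and $m_1=b_1$, $m_t=t^{(a-b)/\zeta}$ (rounded up) for $t\ge2$. Compressed online Sinkhorn: write $\hat f_t=-\epsilon\log\sum_{i=1}^{m_t}e^{(\hat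 q_{i,t}-C(\cdot,\hat y_{i,t}))/\epsilon}$ and $\hat g_t=-\epsilon\log\sum_{i=1}^{m_t}e^{(\hat p_{i,t}-C(\hat x_{i,t},\cdot))/\epsilon}$. Start with $\hat q_{i,1}=\hat p_{i,1}=0$ and i.i.d. samples $\hat x_{i,1}\sim\alpha$, $\hat y_{i,1}\sim\beta$. In iteration $t\ge1$ draw fresh independent samples $x_1,\dots,x_{b_t}\sim\alpha$, $y_1,\dots,y_{b_t}\sim\beta$ and set $$e^{-f_{t+1}/\epsilon}=(1-\eta_t)e^{-\hat f_t/\epsilon}+\frac{\eta_t}{b_t}\sum_{j=1}^{b_t}e^{(\hat g_t(y_j)-C(\cdot,y_j))/\epsilon},\qquad e^{-g_{t+1}/\epsilon}=(1-\eta_t)e^{-\hat g_t/\epsilon}+\frac{\eta_t}{b_t}\sum_{j=1}^{b_t}e^{(f_{t+1}(x_j)-C(x_j,\cdot))/\epsilon};$$ then replace $f_{t+1},g_{t+1}$ by compressed potentials $\hat f_{t+1},\hat g_{t+1}$ of the above form with $m_{t+1}$ points in $\mathcal X$, chosen without knowledge of future samples. Assume that for a constant $K$, almost surely, $\sup_x|f_{t}-\hat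 f_{t}|\le Km_{t}^{-\zeta}$ and $\sup_y|g_{t}-\hat g_{t}|\le Km_{t}^{-\zeta}$ for all $t\ge2$. Let $\|h\|_{var}=\sup h-\inf h$, let $t(N)$ be the first $t$ with $\sum_{i=1}^t b_i>N$, and let $\hat\delta_N=\|(\hat f_{t(N)}-f^*)/\epsilon\|_{var}+\|(\hat g_{t(N)}-g^*)/\epsilon\|_{var}$. Then there are constants $c,A,B>0$, depending on neither $N$ nor the run (probability space, samples, compression scheme with the given $K$), such that for all $N\ge1$ the error $\hat\delta_N$ is integrable and $$\mathbb E\,\hat\delta_N\le A\Big(\exp\big(-cN^{\frac{b+1}{2a+1}}\big)+N^{-\frac{a}{2a+1}}\Big)\le B\,N^{-\frac{a}{2a+1}}.$$ -/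

import Mathlib

open MeasureTheory ProbabilityTheory
open scoped NNReal

namespace COS

noncomputable section

/-- The variation seminorm `sup h - inf h`. -/
def varNorm {X : Type*} (h : X → ℝ) : ℝ := (⨆ x, h x) - ⨅ x, h x

/-- The soft `c`-transform `x ↦ -ε log ∫ exp ((h y - c x y) / ε) dμ(y)`. -/
def softTransform {X : Type*} [MeasurableSpace X] (ε : ℝ) (c : X → X → ℝ) (μ : Measure X)
    (h : X → ℝ) (x : X) : ℝ :=
  -ε * Real.log (∫ y, Real.exp ((h y - c x y) / ε) ∂μ)

/-- The dual objective of entropically regularised optimal transport. -/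
def dualObjective {X : Type*} [MeasurableSpace X] (ε : ℝ) (C : X → X → ℝ) (α β : Measure X)
    (f g : X → ℝ) : ℝ :=
  (∫ x, f x ∂α) + (∫ y, g y ∂β)
    - ε * ∫ z, Real.exp ((f z.1 + g z.2 - C z.1 z.2) / ε) ∂(α.prod β)

/-- `(f, g)` is a pair of optimal potentials: continuous functions that maximise the dual objective
over all pairs of continuous functions. Maximality determines `f` and `g` only on the supports
of `α` and `β`; off the supports they are given by the optimality relations
`f = T_β g`, `g = T_α f`, required at every point. -/
structure IsOptimalPotentials {X : Type*} [TopologicalSpace X] [MeasurableSpace X]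
    (ε : ℝ) (C : X → X → ℝ) (α β : Measure X) (f g : X → ℝ) : Prop where
  continuous_left : Continuous f
  continuous_right : Continuous g
  isMax : ∀ f' g' : X → ℝ, Continuous f' → Continuous g' →
    dualObjective ε C α β f' g' ≤ dualObjective ε C α β f g
  left_eq : ∀ x, f x = softTransform ε C β g x
  right_eq : ∀ y, g y = softTransform ε (fun y x => C x y) α f y

/-- The potential `-ε log ∑ i, exp ((w i - c(·, z i)) / ε)` carried by finitely many weighted
points. -/
def atomicPotential {X : Type*} (ε : ℝ) (c : X → X → ℝ) {m : ℕ} (w : Fin m → ℝ) (z : Fin m → X)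
    (x : X) : ℝ :=
  -ε * Real.log (∑ i, Real.exp ((w i - c x (z i)) / ε))

/-- One (uncompressed) online Sinkhorn half-step. The old points `z i` get the weights
`w i + ε log (1 - η)`, i.e. `exp (w i / ε)` is multiplied by `1 - η`; the `n` new points `ξ j`
get the weights `ε log (η / n) + h (ξ j)`. (In this multiplicative form `η = 1` is allowed.) -/
def onlineUpdate {X : Type*} (ε : ℝ) (c : X → X → ℝ) (η : ℝ) {m n : ℕ} (w : Fin m → ℝ)
    (z : Fin m → X) (h : X → ℝ) (ξ : Fin n → X) (x : X) : ℝ :=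
  -ε * Real.log ((∑ i, (1 - η) * Real.exp ((w i - c x (z i)) / ε))
    + ∑ j, (η / n) * Real.exp ((h (ξ j) - c x (ξ j)) / ε))

/-- Number of samples from each distribution used before iteration `t ≥ 1`:
`n_1 = b_1`, `n_{t+1} = n_t + b_t`. -/
def sampleCount (bs : ℕ → ℕ) (t : ℕ) : ℕ := bs 1 + ∑ i ∈ Finset.Ico 1 t, bs i

/-- A run of compressed online Sinkhorn on a probability space `(Ω, P)`, with learning rates `η`,
batch sizes `bs` and compression sizes `m`. Iterations are numbered `t = 1, 2, …`. The compression
step is not prescribed: its output is any measurable collection of `m t` weighted points which,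
like everything that the algorithm computes, does not look into the future. -/
structure Run {X : Type*} [MeasurableSpace X] (α β : Measure X)
    (η : ℕ → ℝ) (bs m : ℕ → ℕ) {Ω : Type*} [MeasurableSpace Ω] (P : Measure Ω) where
  /-- the samples from `α` -/
  x : ℕ → Ω → X
  /-- the samples from `β` -/
  y : ℕ → Ω → X
  measurable_x : ∀ i, Measurable (x i)
  measurable_y : ∀ i, Measurable (y i)
  law_x : ∀ i, P.map (x i) = α
  law_y : ∀ i, P.map (y i) = β
  /-- all the samples are mutually independent -/
  indep_samples : iIndepFun (Sum.elim x y) P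
  /-- the points and weights that represent the compressed potential `g` -/
  xhat : (t : ℕ) → Ω → Fin (m t) → X
  phat : (t : ℕ) → Ω → Fin (m t) → ℝ
  /-- the points and weights that represent the compressed potential `f` -/
  yhat : (t : ℕ) → Ω → Fin (m t) → X
  qhat : (t : ℕ) → Ω → Fin (m t) → ℝ
  measurable_xhat : ∀ t, 1 ≤ t → Measurable (xhat t)
  measurable_phat : ∀ t, 1 ≤ t → Measurable (phat t)
  measurable_yhat : ∀ t, 1 ≤ t → Measurable (yhat t)
  measurable_qhat : ∀ t, 1 ≤ t → Measurable (qhat t)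
  /-- initialisation with the first samples and zero weights -/
  init_xhat : ∀ ω i, xhat 1 ω i = x i ω
  init_phat : ∀ ω i, phat 1 ω i = 0
  init_yhat : ∀ ω i, yhat 1 ω i = y i ω
  init_qhat : ∀ ω i, qhat 1 ω i = 0
  /-- the state at iteration `t` is independent of the samples not yet drawn -/
  nonanticipating : ∀ t, 1 ≤ t →
    IndepFun (fun ω => (xhat t ω, phat t ω, yhat t ω, qhat t ω))
      (fun ω (i : ℕ) => (x (sampleCount bs t + i) ω, y (sampleCount bs t + i) ω)) P

namespace Run

variable {X : Type*} [MeasurableSpace X] {α β : Measure X} {η : ℕ → ℝ} {bs m : ℕ → ℕ}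
  {Ω : Type*} [MeasurableSpace Ω] {P : Measure Ω}

/-- The compressed potential `f̂_t`. -/
def fhat (R : Run α β η bs m P) (ε : ℝ) (C : X → X → ℝ) (t : ℕ) (ω : Ω) : X → ℝ :=
  atomicPotential ε C (R.qhat t ω) (R.yhat t ω)

/-- The compressed potential `ĝ_t`. -/
def ghat (R : Run α β η bs m P) (ε : ℝ) (C : X → X → ℝ) (t : ℕ) (ω : Ω) : X → ℝ :=
  atomicPotential ε (fun y x => C x y) (R.phat t ω) (R.xhat t ω)

/-- The potential `f_{t+1}` before compression, computed in iteration `t` from `f̂_t`, `ĝ_t` and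
a new batch of samples from `β`. -/
def fnext (R : Run α β η bs m P) (ε : ℝ) (C : X → X → ℝ) (t : ℕ) (ω : Ω) : X → ℝ :=
  onlineUpdate ε C (η t) (R.qhat t ω) (R.yhat t ω) (R.ghat ε C t ω)
    (fun j : Fin (bs t) => R.y (sampleCount bs t + j) ω)

/-- The potential `g_{t+1}` before compression, computed in iteration `t` from `ĝ_t`, `f_{t+1}`
and a new batch of samples from `α`. -/
def gnext (R : Run α β η bs m P) (ε : ℝ) (C : X → X → ℝ) (t : ℕ) (ω : Ω) : X → ℝ :=
  onlineUpdate ε (fun y x => C x y) (η t) (R.phat t ω) (R.xhat t ω) (R.fnext ε C t ω)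
    (fun j : Fin (bs t) => R.x (sampleCount bs t + j) ω)

/-- The compression errors are at most `K * m_t ^ (-ζ)` in supremum norm, almost surely. -/
def CompressionErrorBound (R : Run α β η bs m P) (ε : ℝ) (C : X → X → ℝ) (ζ K : ℝ) : Prop :=
  ∀ᵐ ω ∂P, ∀ t, 1 ≤ t →
    (∀ x, |R.fnext ε C t ω x - R.fhat ε C (t + 1) ω x| ≤ K * (m (t + 1) : ℝ) ^ (-ζ)) ∧
    (∀ y, |R.gnext ε C t ω y - R.ghat ε C (t + 1) ω y| ≤ K * (m (t + 1) : ℝ) ^ (-ζ))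

/-- `t(N)`: the first iteration number `t` for which `b_1 + ⋯ + b_t > N`. -/
def firstIter (bs : ℕ → ℕ) (N : ℕ) : ℕ := sInf {t : ℕ | N < ∑ i ∈ Finset.Icc 1 t, bs i}

/-- The error `‖(f̂_{t(N)} - f*) / ε‖_var + ‖(ĝ_{t(N)} - g*) / ε‖_var`. -/
def errorAt (R : Run α β η bs m P) (ε : ℝ) (C : X → X → ℝ) (fs gs : X → ℝ) (N : ℕ) (ω : Ω) : ℝ :=
  varNorm (fun x => (R.fhat ε C (firstIter bs N) ω x - fs x) / ε)
    + varNorm (fun y => (R.ghat ε C (firstIter bs N) ω y - gs y) / ε)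

end Run

/-- Learning rates `η_t = (t + s) ^ b`. -/
def stepSize (b : ℝ) (s t : ℕ) : ℝ := ((t + s : ℕ) : ℝ) ^ b

/-- Batch sizes `b_t = (t + s) ^ (2a)`, rounded up to an integer. -/
def batchSize (a : ℝ) (s t : ℕ) : ℕ := ⌈((t + s : ℕ) : ℝ) ^ (2 * a)⌉₊

/-- Compression sizes `m_t = t ^ ((a - b) / ζ)`, rounded up to an integer, for `t ≥ 2`; the
uncompressed initial state has `m_1 = b_1` points. -/
def compressionSize (a b ζ : ℝ) (s t : ℕ) : ℕ :=
  if t ≤ 1 then batchSize a s 1 else ⌈(t : ℝ) ^ ((a - b) / ζ)⌉₊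

end

end COS

/-
Write `u = exp ((f* - f) / ε)` for the scaling of a potential relative to the optimal one and
measure the error by the largest ratio of `u` (and of its counterpart for `g`) minus one. In terms
of `u`, an iteration averages `u` with an empirical mean against the density of the optimal plan,
which lies between positive constants: without sampling this contracts the error by a factor
`1 - c η_t`. Sampling adds `η_t` times a deviation of an empirical mean that is uniform over a
bounded Lipschitz family, of mean `O(1 / √b_t)` by chaining along dyadic nets; compression
multiplies ratios by `exp (O(m_t ^ (-ζ)))`, which is summable, so that `u` stays at a bounded scale.
Hence `d_{t+1} ≤ (1 - c t ^ b) d_t + G t ^ (b - a)` for the mean error, which gives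
`d_t = O(t ^ (-a))`, and `t(N)` is of order `N ^ (1 / (2 a + 1))`.
-/

namespace COS

noncomputable section

section Envelope

variable {Ω ι κ : Type*} [MeasurableSpace Ω] {P : Measure Ω} {Z Z' : ι → Ω → ℝ} {r r' : ℝ}

/-- The family `Z` has a common integrable majorant of mean at most `r`. This expresses
`𝔼 supᵢ |Zᵢ| ≤ r` without requiring the supremum over an uncountable family to be measurable. -/
def HasEnvelope (Z : ι → Ω → ℝ) (P : Measure Ω) (r : ℝ) : Prop :=
  ∃ G : Ω → ℝ, Integrable G P ∧ (∀ i ω, |Z i ω| ≤ G ω) ∧ ∫ ω, G ω ∂P ≤ r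

theorem HasEnvelope.mono (h : HasEnvelope Z P r) (hr : r ≤ r') : HasEnvelope Z P r' :=
  let ⟨G, hG, hZ, hI⟩ := h
  ⟨G, hG, hZ, hI.trans hr⟩

theorem HasEnvelope.comp (h : HasEnvelope Z P r) (f : κ → ι) :
    HasEnvelope (fun k => Z (f k)) P r :=
  let ⟨G, hG, hZ, hI⟩ := h
  ⟨G, hG, fun k => hZ (f k), hI⟩

theorem HasEnvelope.add (h : HasEnvelope Z P r) (h' : HasEnvelope Z' P r') :
    HasEnvelope (fun i ω => Z i ω + Z' i ω) P (r + r') := by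
  obtain ⟨G, hG, hZ, hI⟩ := h
  obtain ⟨G', hG', hZ', hI'⟩ := h'
  refine ⟨fun ω => G ω + G' ω, hG.add hG',
    fun i ω => (abs_add_le _ _).trans (add_le_add (hZ i ω) (hZ' i ω)), ?_⟩
  rw [integral_add hG hG']
  exact add_le_add hI hI'

theorem HasEnvelope.of_abs_le [IsProbabilityMeasure P] (h : ∀ i ω, |Z i ω| ≤ r) :
    HasEnvelope Z P r :=
  ⟨fun _ => r, integrable_const _, h, by simp⟩

theorem HasEnvelope.sum_range {Z : ℕ → ι → Ω → ℝ} {r : ℕ → ℝ}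
    (h : ∀ j, HasEnvelope (Z j) P (r j)) (J : ℕ) :
    HasEnvelope (fun i ω => ∑ j ∈ Finset.range J, Z j i ω) P (∑ j ∈ Finset.range J, r j) := by
  induction J with
  | zero => exact ⟨0, integrable_zero _ _ _, by simp, by simp⟩
  | succ J ih =>
    simp only [Finset.sum_range_succ]
    exact ih.add (h J)

theorem exp_abs_le_exp_add_exp_neg (x : ℝ) : Real.exp |x| ≤ Real.exp x + Real.exp (-x) := by
  rcases abs_cases x with ⟨h, _⟩ | ⟨h, _⟩ <;> rw [h]
  · linarith [Real.exp_pos (-x)]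
  · linarith [Real.exp_pos x]

theorem integral_exp_add_exp_neg_le {X : Ω → ℝ}
    (h : HasSubgaussianMGF X 1 P) : ∫ ω, (Real.exp (X ω) + Real.exp (-X ω)) ∂P ≤ Real.exp 2 := by
  have half (Y : Ω → ℝ) (hY : HasSubgaussianMGF Y 1 P) :
      Integrable (fun ω => Real.exp (Y ω)) P ∧ ∫ ω, Real.exp (Y ω) ∂P ≤ Real.exp (1 / 2) := by
    simpa [mgf] using And.intro (hY.integrable_exp_mul 1) (hY.mgf_le 1)
  obtain ⟨hi, hle⟩ := half X h
  obtain ⟨hi', hle'⟩ := half (fun ω => -X ω) h.neg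
  rw [integral_add hi hi']
  have two_le : 2 ≤ Real.exp (3 / 2) := by linarith [Real.add_one_le_exp (3 / 2 : ℝ)]
  calc _ ≤ Real.exp (1 / 2) * 2 := by linarith
    _ ≤ Real.exp (1 / 2) * Real.exp (3 / 2) := by gcongr
    _ = Real.exp 2 := by rw [← Real.exp_add]; norm_num

theorem HasEnvelope.of_hasSubgaussianMGF_one [IsProbabilityMeasure P] {Λ : ℝ} (S : Finset ι)
    (hZ : ∀ i ∈ S, HasSubgaussianMGF (Z i) 1 P) (hS : (S.card : ℝ) ≤ Real.exp Λ) :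
    HasEnvelope (fun i : S => Z i) P (Λ + 2) := by
  set W : ι → Ω → ℝ := fun i ω => Real.exp (Z i ω) + Real.exp (-Z i ω)
  have hW : ∀ i ∈ S, Integrable (W i) P := fun i hi => by
    simpa [W, Pi.add_def] using
      ((hZ i hi).integrable_exp_mul 1).add ((hZ i hi).integrable_exp_mul (-1))
  have hsum : Integrable (fun ω => ∑ i ∈ S, W i ω) P := integrable_finsetSum S hW
  have hmean : ∫ ω, ∑ i ∈ S, W i ω ∂P ≤ Real.exp (Λ + 2) := by
    rw [integral_finsetSum S hW, Real.exp_add]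
    calc ∑ i ∈ S, ∫ ω, W i ω ∂P ≤ S.card • Real.exp 2 :=
          Finset.sum_le_card_nsmul _ _ _ fun i hi => integral_exp_add_exp_neg_le (hZ i hi)
      _ ≤ Real.exp Λ * Real.exp 2 := by rw [nsmul_eq_mul]; gcongr
  -- `z ≤ e ^ (z - k) + k - 1` with `k = Λ + 2` replaces the supremum by a sum.
  refine ⟨fun ω => (∑ i ∈ S, W i ω) * Real.exp (-(Λ + 2)) + (Λ + 1),
    (hsum.mul_const _).add (integrable_const _), fun ⟨i, hi⟩ ω => ?_, ?_⟩
  · have hle : Real.exp |Z i ω| ≤ ∑ i ∈ S, W i ω :=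
      (exp_abs_le_exp_add_exp_neg _).trans <|
        Finset.single_le_sum (f := fun i => W i ω) (fun j _ => by positivity) hi
    have := mul_le_mul_of_nonneg_right hle (Real.exp_pos (-(Λ + 2))).le
    rw [← Real.exp_add] at this
    linarith [Real.add_one_le_exp (|Z i ω| + -(Λ + 2))]
  · rw [integral_add (hsum.mul_const _) (integrable_const _), integral_mul_const, integral_const,
      probReal_univ, one_smul]
    have := mul_le_mul_of_nonneg_right hmean (Real.exp_pos (-(Λ + 2))).le
    rw [← Real.exp_add, add_neg_cancel, Real.exp_zero] at this
    linarith

theorem HasEnvelope.const_mul (h : HasEnvelope Z P r) {σ : ℝ} (hσ : 0 ≤ σ) :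
    HasEnvelope (fun i ω => σ * Z i ω) P (σ * r) := by
  obtain ⟨G, hG, hZ, hI⟩ := h
  refine ⟨fun ω => σ * G ω, hG.const_mul σ, fun i ω => ?_, ?_⟩
  · rw [abs_mul, abs_of_nonneg hσ]
    exact mul_le_mul_of_nonneg_left (hZ i ω) hσ
  · rw [integral_const_mul]
    exact mul_le_mul_of_nonneg_left hI hσ

theorem hasSubgaussianMGF_nnreal_mul {X : Ω → ℝ} {c : ℝ≥0} (h : HasSubgaussianMGF X c P)
    (k : ℝ≥0) : HasSubgaussianMGF (fun ω => (k : ℝ) * X ω) (k ^ 2 * c) P :=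
  h.const_mul (k : ℝ)

theorem HasEnvelope.of_hasSubgaussianMGF [IsProbabilityMeasure P] {σ : ℝ≥0} (hσ : 0 < σ) {Λ : ℝ}
    (S : Finset ι) (hZ : ∀ i ∈ S, HasSubgaussianMGF (Z i) (σ ^ 2) P)
    (hS : (S.card : ℝ) ≤ Real.exp Λ) :
    HasEnvelope (fun i : S => Z i) P (σ * (Λ + 2)) := by
  have hone : ∀ i ∈ S, HasSubgaussianMGF (fun ω => ((σ⁻¹ : ℝ≥0) : ℝ) * Z i ω) 1 P := fun i hi => by
    convert hasSubgaussianMGF_nnreal_mul (hZ i hi) σ⁻¹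
    rw [← mul_pow, inv_mul_cancel₀ hσ.ne', one_pow]
  simpa [hσ.ne'] using
    (HasEnvelope.of_hasSubgaussianMGF_one S hone hS).const_mul σ.coe_nonneg

end Envelope

section EmpiricalDeviation

variable {Y : Type*} [MeasurableSpace Y] {μ : Measure Y} {ψ ψ' : Y → ℝ} {n : ℕ}

/-- The deviation of the empirical mean of `ψ` over the sample `ξ` from its expectation. -/
def empiricalDeviation (μ : Measure Y) (ψ : Y → ℝ) (ξ : Fin n → Y) : ℝ :=
  (∑ j, ψ (ξ j)) / n - ∫ y, ψ y ∂μ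

theorem empiricalDeviation_sub (h : Integrable ψ μ) (h' : Integrable ψ' μ) (ξ : Fin n → Y) :
    empiricalDeviation μ (fun y => ψ y - ψ' y) ξ
      = empiricalDeviation μ ψ ξ - empiricalDeviation μ ψ' ξ := by
  simp only [empiricalDeviation, Finset.sum_sub_distrib, integral_sub h h']
  ring

theorem empiricalDeviation_eq_sum (hn : 1 ≤ n) (ξ : Fin n → Y) :
    empiricalDeviation μ ψ ξ = (n : ℝ)⁻¹ * ∑ j, (ψ (ξ j) - ∫ y, ψ y ∂μ) := by
  have hn' : (n : ℝ) ≠ 0 := by positivity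
  simp only [empiricalDeviation, Finset.sum_sub_distrib, Finset.sum_const, Finset.card_univ,
    Fintype.card_fin, nsmul_eq_mul]
  field_simp

variable [IsProbabilityMeasure μ]

theorem abs_empiricalDeviation_le {M : ℝ} (hM : ∀ y, |ψ y| ≤ M) (hn : 1 ≤ n) (ξ : Fin n → Y) :
    |empiricalDeviation μ ψ ξ| ≤ 2 * M := by
  have hn' : (0 : ℝ) < n := by exact_mod_cast hn
  have hsample : |(∑ j, ψ (ξ j)) / n| ≤ M := by
    rw [abs_div, abs_of_pos hn', div_le_iff₀ hn']
    refine (Finset.abs_sum_le_sum_abs _ _).trans ((Finset.sum_le_sum fun j _ => hM (ξ j)).trans ?_)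
    simp [mul_comm]
  have hmean : |∫ y, ψ y ∂μ| ≤ M := by
    simpa using norm_integral_le_of_norm_le_const (μ := μ) (f := ψ) (Filter.Eventually.of_forall hM)
  exact (abs_sub _ _).trans (by linarith)

theorem hasSubgaussianMGF_empiricalDeviation (hψ : Measurable ψ) {M : ℝ≥0}
    (hM : ∀ y, |ψ y| ≤ M) (hn : 1 ≤ n) :
    HasSubgaussianMGF (fun ξ : Fin n → Y => empiricalDeviation μ ψ ξ) ((M / NNReal.sqrt n) ^ 2)
      (Measure.pi fun _ => μ) := by
  set X : Y → ℝ := fun y => ψ y - ∫ y, ψ y ∂μ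
  have hX : HasSubgaussianMGF X (M ^ 2) μ := by
    convert hasSubgaussianMGF_of_mem_Icc (μ := μ) (a := -M) (b := M) hψ.aemeasurable
      (Filter.Eventually.of_forall fun y => abs_le.mp (hM y)) using 2
    ext
    simp [← two_mul]
  have hindep : iIndepFun (fun (i : Fin n) (ξ : Fin n → Y) => X (ξ i)) (Measure.pi fun _ => μ) :=
    iIndepFun_pi fun _ => (hψ.sub_const _).aemeasurable
  have hcoord : ∀ i ∈ (Finset.univ : Finset (Fin n)),
      HasSubgaussianMGF (fun ξ : Fin n → Y => X (ξ i)) (M ^ 2) (Measure.pi fun _ => μ) := by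
    intro i _
    have heval := measurePreserving_eval (fun _ : Fin n => μ) i
    refine HasSubgaussianMGF.of_map (X := X) (Y := Function.eval i) heval.measurable.aemeasurable ?_
    rwa [heval.map_eq]
  convert hasSubgaussianMGF_nnreal_mul (HasSubgaussianMGF.sum_of_iIndepFun hindep hcoord)
    (n : ℝ≥0)⁻¹ using 1
  · ext ξ
    rw [empiricalDeviation_eq_sum hn, NNReal.coe_inv, NNReal.coe_natCast]
  · have hn' : (n : ℝ≥0) ≠ 0 := by positivity
    simp only [Finset.sum_const, Finset.card_univ, Fintype.card_fin, nsmul_eq_mul, div_pow,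
      NNReal.sq_sqrt]
    field_simp

end EmpiricalDeviation

section DyadicNets

/-- Finite nets `S` with projections `π` onto them at all dyadic scales, of exponentially bounded
size: the entropy condition that chaining needs. -/
def HasDyadicNets (X : Type*) [PseudoMetricSpace X] (D : ℝ) : Prop :=
  ∀ j : ℕ, ∃ (π : X → X) (S : Finset X), (∀ x, π x ∈ S) ∧
    (S.card : ℝ) ≤ Real.exp (D * (j + 1)) ∧ ∀ x, dist (π x) x ≤ D * (1 / 2) ^ j

variable {d : ℕ}

/-- The integer label of the dyadic cube of side `2 ^ (-j)` that contains `x`. -/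
def dyadicCell (j : ℕ) (x : EuclideanSpace ℝ (Fin d)) : Fin d → ℤ := fun i => ⌊(2 : ℝ) ^ j * x i⌋

theorem dist_le_of_dyadicCell_eq {j : ℕ} {x x' : EuclideanSpace ℝ (Fin d)}
    (h : dyadicCell j x = dyadicCell j x') : dist x x' ≤ d * (1 / 2) ^ j := by
  have hcoord (i : Fin d) : dist (x i) (x' i) ≤ (1 / 2) ^ j := by
    have hlt := Int.abs_sub_lt_one_of_floor_eq_floor (congrFun h i)
    rw [← mul_sub, abs_mul, abs_of_pos (by positivity)] at hlt
    rw [Real.dist_eq, one_div_pow, le_div_iff₀ (by positivity)]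
    linarith
  rw [EuclideanSpace.dist_eq]
  refine Real.sqrt_le_iff.2 ⟨by positivity, ?_⟩
  calc ∑ i, dist (x i) (x' i) ^ 2 ≤ ∑ _i : Fin d, ((1 / 2 : ℝ) ^ j) ^ 2 := by
        gcongr with i
        exact hcoord i
    _ = d * ((1 / 2 : ℝ) ^ j) ^ 2 := by simp
    _ ≤ (d * (1 / 2) ^ j) ^ 2 := by
        rw [mul_pow]
        gcongr
        exact_mod_cast Nat.le_self_pow two_ne_zero d

/-- The labels of the dyadic cubes of side `2 ^ (-j)` that meet the ball of radius `R`. -/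
def dyadicCells (d j : ℕ) (R : ℝ) : Finset (Fin d → ℤ) :=
  Fintype.piFinset fun _ => Finset.Icc (-(⌈2 ^ j * R⌉₊ : ℤ)) ⌈2 ^ j * R⌉₊

theorem dyadicCell_mem_dyadicCells {R : ℝ} (j : ℕ) {x : EuclideanSpace ℝ (Fin d)}
    (hx : ‖x‖ ≤ R) : dyadicCell j x ∈ dyadicCells d j R := by
  refine Fintype.mem_piFinset.2 fun i => Finset.mem_Icc.2 ?_
  have hle : |2 ^ j * x i| ≤ (⌈2 ^ j * R⌉₊ : ℝ) := by
    rw [abs_mul, abs_of_pos (by positivity)]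
    calc 2 ^ j * |x i| ≤ 2 ^ j * R := by
          gcongr
          exact (PiLp.norm_apply_le x i).trans hx
      _ ≤ _ := Nat.le_ceil _
  obtain ⟨hlow, hup⟩ := abs_le.1 hle
  exact ⟨Int.le_floor.2 (by push_cast; exact hlow),
    (Int.floor_le_floor hup).trans_eq (Int.floor_natCast _)⟩

theorem card_dyadicCells_le (d j : ℕ) {R : ℝ} (hR : 0 ≤ R) :
    ((dyadicCells d j R).card : ℝ) ≤ Real.exp (d * (2 * R + 3) * (j + 1)) := by
  have hcard : ((dyadicCells d j R).card : ℝ) = (2 * ⌈2 ^ j * R⌉₊ + 1 : ℝ) ^ d := by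
    rw [dyadicCells, Fintype.card_piFinset]
    simp only [Int.card_Icc, Finset.prod_const, Finset.card_univ, Fintype.card_fin]
    rw [show ((⌈2 ^ j * R⌉₊ : ℤ) + 1 - -(⌈2 ^ j * R⌉₊ : ℤ)).toNat = 2 * ⌈2 ^ j * R⌉₊ + 1 by lia]
    push_cast
    rfl
  have hpow : (1 : ℝ) ≤ 2 ^ j := one_le_pow₀ (by norm_num)
  have hceil : (⌈2 ^ j * R⌉₊ : ℝ) ≤ 2 ^ j * R + 1 := (Nat.ceil_lt_add_one (by positivity)).le
  have hside : (2 * ⌈2 ^ j * R⌉₊ + 1 : ℝ) ≤ Real.exp ((2 * R + 3) * (j + 1)) :=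
    calc (2 * ⌈2 ^ j * R⌉₊ + 1 : ℝ) ≤ 2 ^ j * (2 * R + 3) := by linarith
      _ ≤ Real.exp 1 ^ j * Real.exp (2 * R + 3) := by
        gcongr
        · linarith [Real.add_one_le_exp 1]
        · linarith [Real.add_one_le_exp (2 * R + 3)]
      _ = Real.exp (j + (2 * R + 3)) := by rw [Real.exp_one_pow, Real.exp_add j]
      _ ≤ _ := Real.exp_le_exp.2 (by nlinarith [Nat.cast_nonneg (α := ℝ) j])
  calc ((dyadicCells d j R).card : ℝ) ≤ Real.exp ((2 * R + 3) * (j + 1)) ^ d := by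
        rw [hcard]
        gcongr
    _ = Real.exp (d * (2 * R + 3) * (j + 1)) := by rw [← Real.exp_nat_mul, mul_assoc]

theorem exists_hasDyadicNets (𝒳 : Set (EuclideanSpace ℝ (Fin d)))
    (h𝒳 : Bornology.IsBounded 𝒳) : ∃ D : ℝ, 0 < D ∧ HasDyadicNets 𝒳 D := by
  classical
  obtain ⟨R, hR, hbound⟩ := h𝒳.exists_pos_norm_le
  refine ⟨d * (2 * R + 3) + 1, by positivity, fun j => ?_⟩
  rcases isEmpty_or_nonempty 𝒳 with he | hne
  · exact ⟨id, ∅, he.elim, by simp [Real.exp_nonneg], he.elim⟩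
  let cell : 𝒳 → Fin d → ℤ := fun x => dyadicCell j x
  refine ⟨fun x => Function.invFun cell (cell x),
    (dyadicCells d j R).image (Function.invFun cell),
    fun x => Finset.mem_image_of_mem _ (dyadicCell_mem_dyadicCells j (hbound x x.2)), ?_,
    fun x => ?_⟩
  · calc (((dyadicCells d j R).image (Function.invFun cell)).card : ℝ)
        ≤ (dyadicCells d j R).card := by exact_mod_cast Finset.card_image_le
      _ ≤ Real.exp (d * (2 * R + 3) * (j + 1)) := card_dyadicCells_le d j hR.le
      _ ≤ _ := by
        gcongr
        linarith
  · refine (dist_le_of_dyadicCell_eq (Function.invFun_eq (f := cell) ⟨x, rfl⟩)).trans ?_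
    gcongr
    nlinarith [Nat.cast_nonneg (α := ℝ) d]

end DyadicNets

section Chaining

variable {X Y : Type*} [PseudoMetricSpace X] [MeasurableSpace Y] {μ : Measure Y}
  {D M : ℝ} {ψ : X → Y → ℝ} {n : ℕ}

/-- A family of measurable functions on `Y`, bounded by `M` and `M`-Lipschitz in its index. -/
structure IsBoundedLipschitzFamily (M : ℝ) (ψ : X → Y → ℝ) : Prop where
  measurable : ∀ x, Measurable (ψ x)
  abs_le : ∀ x y, |ψ x y| ≤ M
  lipschitz : ∀ x x' y, |ψ x y - ψ x' y| ≤ M * dist x x'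

variable [IsProbabilityMeasure μ]

theorem IsBoundedLipschitzFamily.integrable (hψ : IsBoundedLipschitzFamily M ψ) (x : X) :
    Integrable (ψ x) μ :=
  .of_bound (hψ.measurable x).aestronglyMeasurable M (Filter.Eventually.of_forall (hψ.abs_le x))

theorem hasEnvelope_empiricalDeviation_finset {ι : Type*} {φ : ι → Y → ℝ} {Λ : ℝ} (hM : 0 < M)
    (S : Finset ι) (hφ : ∀ i ∈ S, Measurable (φ i)) (hφM : ∀ i ∈ S, ∀ y, |φ i y| ≤ M)
    (hS : (S.card : ℝ) ≤ Real.exp Λ) (hn : 1 ≤ n) :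
    HasEnvelope (fun (i : S) (ξ : Fin n → Y) => empiricalDeviation μ (φ i) ξ)
      (Measure.pi fun _ => μ) (M / √n * (Λ + 2)) := by
  lift M to ℝ≥0 using hM.le
  have hσ : 0 < M / NNReal.sqrt n :=
    div_pos (by exact_mod_cast hM) (NNReal.sqrt_pos.2 (by positivity))
  simpa using HasEnvelope.of_hasSubgaussianMGF
    (Z := fun i (ξ : Fin n → Y) => empiricalDeviation μ (φ i) ξ) hσ S
    (fun i hi => hasSubgaussianMGF_empiricalDeviation (hφ i hi) (hφM i hi) hn) hS

theorem IsBoundedLipschitzFamily.abs_empiricalDeviation_sub_le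
    (hψ : IsBoundedLipschitzFamily M ψ) (hn : 1 ≤ n) (x x' : X) (ξ : Fin n → Y) :
    |empiricalDeviation μ (ψ x) ξ - empiricalDeviation μ (ψ x') ξ| ≤ 2 * (M * dist x x') := by
  rw [← empiricalDeviation_sub (hψ.integrable x) (hψ.integrable x')]
  exact abs_empiricalDeviation_le (hψ.lipschitz x x') hn ξ

theorem hasEnvelope_empiricalDeviation_link (hD : 0 < D) (hM : 0 < M)
    (hψ : IsBoundedLipschitzFamily M ψ) {π π' : X → X} {S S' : Finset X} {j : ℕ}
    (hπ : ∀ x, π x ∈ S) (hπ' : ∀ x, π' x ∈ S')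
    (hS : (S.card : ℝ) ≤ Real.exp (D * (j + 1)))
    (hS' : (S'.card : ℝ) ≤ Real.exp (D * (j + 2)))
    (hdist : ∀ x, dist (π' x) (π x) ≤ 2 * D * (1 / 2) ^ j) (hn : 1 ≤ n) :
    HasEnvelope (fun x (ξ : Fin n → Y) =>
        empiricalDeviation μ (ψ (π' x)) ξ - empiricalDeviation μ (ψ (π x)) ξ)
      (Measure.pi fun _ => μ) (M * (2 * D * (1 / 2) ^ j) / √n * (D * (2 * j + 3) + 2)) := by
  set Q : Finset (X × X) := (S' ×ˢ S).filter fun p => dist p.1 p.2 ≤ 2 * D * (1 / 2) ^ j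
  have hQ : (Q.card : ℝ) ≤ Real.exp (D * (2 * j + 3)) :=
    calc (Q.card : ℝ) ≤ S'.card * S.card := by
          exact_mod_cast (Finset.card_filter_le _ _).trans_eq (Finset.card_product _ _)
      _ ≤ Real.exp (D * (j + 2)) * Real.exp (D * (j + 1)) := by gcongr
      _ = _ := by
          rw [← Real.exp_add]
          ring_nf
  have hQM : ∀ p ∈ Q, ∀ y, |ψ p.1 y - ψ p.2 y| ≤ M * (2 * D * (1 / 2) ^ j) := fun p hp y => by
    refine (hψ.lipschitz _ _ _).trans ?_
    gcongr
    exact (Finset.mem_filter.1 hp).2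
  have hQmem (x : X) : (π' x, π x) ∈ Q :=
    Finset.mem_filter.2 ⟨Finset.mk_mem_product (hπ' x) (hπ x), hdist x⟩
  have henv := (hasEnvelope_empiricalDeviation_finset (μ := μ) (by positivity) Q
    (fun p _ => (hψ.measurable p.1).sub (hψ.measurable p.2)) hQM hQ hn).comp
    fun x => ⟨(π' x, π x), hQmem x⟩
  simpa only [Pi.sub_def, empiricalDeviation_sub (hψ.integrable _) (hψ.integrable _)] using henv

theorem sum_range_half_pow_mul_le (hD : 0 ≤ D) (J : ℕ) :
    ∑ j ∈ Finset.range J, (1 / 2 : ℝ) ^ j * (D * (2 * j + 3) + 2) ≤ 10 * D + 4 := by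
  suffices h : ∑ j ∈ Finset.range J, (1 / 2 : ℝ) ^ j * (D * (2 * j + 3) + 2)
      = 10 * D + 4 - (1 / 2) ^ J * (4 * D * J + 10 * D + 4) by
    rw [h]
    exact sub_le_self _ (by positivity)
  induction J with
  | zero => simp
  | succ J ih =>
    rw [Finset.sum_range_succ, ih]
    push_cast
    ring

theorem hasEnvelope_empiricalDeviation (hX : HasDyadicNets X D) (hD : 0 < D) (hM : 0 < M)
    (hψ : IsBoundedLipschitzFamily M ψ) (hn : 1 ≤ n) :
    HasEnvelope (fun x (ξ : Fin n → Y) => empiricalDeviation μ (ψ x) ξ)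
      (Measure.pi fun _ => μ) (M * (20 * D ^ 2 + 9 * D + 3) / √n) := by
  choose π S hS hcard hdist using hX
  have hsqrt : 0 < √(n : ℝ) := Real.sqrt_pos.2 (by exact_mod_cast hn)
  obtain ⟨J, hJ⟩ : ∃ J : ℕ, (1 / 2 : ℝ) ^ J < 1 / (2 * D * √n) :=
    exists_pow_lt_of_lt_one (by positivity) (by norm_num)
  have hroot := (hasEnvelope_empiricalDeviation_finset (μ := μ) (Λ := D) hM (S 0)
    (fun x _ => hψ.measurable x) (fun x _ => hψ.abs_le x) (by simpa using hcard 0) hn).comp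
    fun x => ⟨π 0 x, hS 0 x⟩
  have hlinks := HasEnvelope.sum_range (fun j => hasEnvelope_empiricalDeviation_link (μ := μ)
    hD hM hψ (hS j) (hS (j + 1)) (hcard j)
    (by simpa [add_assoc, one_add_one_eq_two] using hcard (j + 1)) (fun x => by
      refine (dist_triangle_right _ _ x).trans ?_
      have hj := hdist j x
      have hj' := hdist (j + 1) x
      rw [pow_succ] at hj'
      nlinarith [show 0 ≤ D * (1 / 2) ^ j by positivity]) hn) J
  have htail : HasEnvelope (fun x (ξ : Fin n → Y) => empiricalDeviation μ (ψ x) ξ -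
      empiricalDeviation μ (ψ (π J x)) ξ) (Measure.pi fun _ => μ) (M / √n) := by
    refine HasEnvelope.of_abs_le fun x ξ => (hψ.abs_empiricalDeviation_sub_le hn _ _ ξ).trans ?_
    have hx := hdist J x
    rw [lt_div_iff₀ (by positivity)] at hJ
    rw [le_div_iff₀ hsqrt, dist_comm]
    calc 2 * (M * dist (π J x) x) * √n ≤ 2 * (M * (D * (1 / 2) ^ J)) * √n := by gcongr
      _ = M * ((1 / 2) ^ J * (2 * D * √n)) := by ring
      _ ≤ M := mul_le_of_le_one_right hM.le hJ.le
  have hchain := ((hroot.add hlinks).add htail).mono (r' := M * (20 * D ^ 2 + 9 * D + 3) / √n) ?_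
  · convert hchain using 3 with x ξ
    rw [Finset.sum_range_sub fun j => empiricalDeviation μ (ψ (π j x)) ξ]
    ring
  · have hsum := mul_le_mul_of_nonneg_left (sum_range_half_pow_mul_le hD.le J)
      (show 0 ≤ M * (2 * D) / √n by positivity)
    rw [Finset.mul_sum] at hsum
    calc _ = M / √n * (D + 2) + ∑ j ∈ Finset.range J,
          M * (2 * D) / √n * ((1 / 2 : ℝ) ^ j * (D * (2 * j + 3) + 2)) + M / √n := by
          congr 2
          exact Finset.sum_congr rfl fun j _ => by ring
      _ ≤ M / √n * (D + 2) + M * (2 * D) / √n * (10 * D + 4) + M / √n := by gcongr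
      _ = _ := by ring

end Chaining

section Measurability

variable {Ω X : Type*} [MeasurableSpace Ω] [TopologicalSpace X]
  [TopologicalSpace.SeparableSpace X] {F : Ω → X → ℝ}

theorem measurable_iSup_of_continuous (hm : ∀ x, Measurable fun ω => F ω x)
    (hc : ∀ ω, Continuous (F ω)) : Measurable fun ω => ⨆ x, F ω x := by
  obtain ⟨S, hS, hdense⟩ := TopologicalSpace.exists_countable_dense X
  have : Countable S := hS.to_subtype
  simp only [← hdense.ciSup' (hc _)]
  exact Measurable.iSup fun x : S => hm x

theorem measurable_iInf_of_continuous (hm : ∀ x, Measurable fun ω => F ω x)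
    (hc : ∀ ω, Continuous (F ω)) : Measurable fun ω => ⨅ x, F ω x := by
  obtain ⟨S, hS, hdense⟩ := TopologicalSpace.exists_countable_dense X
  have : Countable S := hS.to_subtype
  simp only [← hdense.ciInf' (hc _)]
  exact Measurable.iInf fun x : S => hm x

theorem measurable_varNorm (hm : ∀ x, Measurable fun ω => F ω x)
    (hc : ∀ ω, Continuous (F ω)) : Measurable fun ω => varNorm (F ω) :=
  (measurable_iSup_of_continuous hm hc).sub (measurable_iInf_of_continuous hm hc)

end Measurability

section SupDeviation

variable {X Y Θ Ω : Type*} [MeasurableSpace Y] {μ : Measure Y} {D M : ℝ} {n : ℕ}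

/-- The largest deviation over a family of functions. -/
def supDeviation (μ : Measure Y) (ψ : X → Y → ℝ) (ξ : Fin n → Y) : ℝ :=
  ⨆ x, |empiricalDeviation μ (ψ x) ξ|

theorem supDeviation_nonneg (ψ : X → Y → ℝ) (ξ : Fin n → Y) :
    0 ≤ supDeviation μ ψ ξ :=
  Real.iSup_nonneg fun _ => abs_nonneg _

variable [PseudoMetricSpace X] [IsProbabilityMeasure μ]

theorem abs_empiricalDeviation_le_supDeviation {ψ : X → Y → ℝ}
    (hψ : IsBoundedLipschitzFamily M ψ) (hn : 1 ≤ n) (ξ : Fin n → Y) (x : X) :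
    |empiricalDeviation μ (ψ x) ξ| ≤ supDeviation μ ψ ξ :=
  le_ciSup (f := fun x => |empiricalDeviation μ (ψ x) ξ|)
    ⟨2 * M, Set.forall_mem_range.2 fun x => abs_empiricalDeviation_le (hψ.abs_le x) hn ξ⟩ x

theorem IsBoundedLipschitzFamily.continuous_empiricalDeviation {ψ : X → Y → ℝ}
    (hψ : IsBoundedLipschitzFamily M ψ) (hn : 1 ≤ n) (ξ : Fin n → Y) :
    Continuous fun x => empiricalDeviation μ (ψ x) ξ := by
  refine (LipschitzWith.of_dist_le_mul (K := Real.toNNReal (2 * M)) fun x x' => ?_).continuous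
  rw [Real.dist_eq]
  refine (hψ.abs_empiricalDeviation_sub_le hn x x' ξ).trans ?_
  rw [← mul_assoc]
  gcongr
  exact Real.le_coe_toNNReal _

theorem measurable_supDeviation [MeasurableSpace Θ] [TopologicalSpace.SeparableSpace X]
    {ψ : Θ → X → Y → ℝ} (hmeas : ∀ x, Measurable fun p : Θ × Y => ψ p.1 x p.2)
    (hψ : ∀ θ, IsBoundedLipschitzFamily M (ψ θ)) (hn : 1 ≤ n) :
    Measurable fun p : Θ × (Fin n → Y) => supDeviation μ (ψ p.1) p.2 := by
  refine measurable_iSup_of_continuous (F := fun (p : Θ × (Fin n → Y)) x =>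
      |empiricalDeviation μ (ψ p.1 x) p.2|)
    (fun x => continuous_abs.measurable.comp (Measurable.sub (Measurable.div_const ?_ _) ?_))
    fun p => ((hψ p.1).continuous_empiricalDeviation hn p.2).abs
  · exact Finset.measurable_fun_sum _ fun j _ => (hmeas x).comp
      (measurable_fst.prodMk ((measurable_pi_apply j).comp measurable_snd))
  · exact ((hmeas x).stronglyMeasurable.integral_prod_right' (ν := μ)).measurable.comp
      measurable_fst

variable [Nonempty X]

theorem supDeviation_le {ψ : X → Y → ℝ} (hψ : IsBoundedLipschitzFamily M ψ) (hn : 1 ≤ n)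
    (ξ : Fin n → Y) : supDeviation μ ψ ξ ≤ 2 * M :=
  ciSup_le fun x => abs_empiricalDeviation_le (hψ.abs_le x) hn ξ

theorem integral_supDeviation_le {ψ : X → Y → ℝ} (hX : HasDyadicNets X D) (hD : 0 < D)
    (hM : 0 < M) (hψ : IsBoundedLipschitzFamily M ψ) (hn : 1 ≤ n) :
    ∫ ξ, supDeviation μ ψ ξ ∂(Measure.pi fun _ : Fin n => μ)
      ≤ M * (20 * D ^ 2 + 9 * D + 3) / √n := by
  obtain ⟨G, hG, hle, hI⟩ := hasEnvelope_empiricalDeviation (μ := μ) hX hD hM hψ hn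
  exact (integral_mono_of_nonneg (Filter.Eventually.of_forall fun ξ => supDeviation_nonneg ψ ξ) hG
    (Filter.Eventually.of_forall fun ξ => ciSup_le fun x => hle x ξ)).trans hI

variable [TopologicalSpace.SeparableSpace X] [MeasurableSpace Θ] [MeasurableSpace Ω]
  {P : Measure Ω} [IsProbabilityMeasure P] {ψ : Θ → X → Y → ℝ} {θ : Ω → Θ} {ξ : Ω → Fin n → Y}

theorem integrable_supDeviation (hmeas : ∀ x, Measurable fun p : Θ × Y => ψ p.1 x p.2)
    (hψ : ∀ θ, IsBoundedLipschitzFamily M (ψ θ)) (hn : 1 ≤ n) (hθ : Measurable θ)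
    (hξ : Measurable ξ) : Integrable (fun ω => supDeviation μ (ψ (θ ω)) (ξ ω)) P :=
  .of_bound ((measurable_supDeviation hmeas hψ hn).comp (hθ.prodMk hξ)).aestronglyMeasurable
    (2 * M) (Filter.Eventually.of_forall fun ω => by
      rw [Real.norm_of_nonneg (supDeviation_nonneg _ _)]
      exact supDeviation_le (hψ _) hn _)

theorem integral_supDeviation_le_of_indepFun (hX : HasDyadicNets X D) (hD : 0 < D) (hM : 0 < M)
    (hmeas : ∀ x, Measurable fun p : Θ × Y => ψ p.1 x p.2)
    (hψ : ∀ θ, IsBoundedLipschitzFamily M (ψ θ)) (hn : 1 ≤ n) (hθ : Measurable θ)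
    (hξ : Measurable ξ) (hind : IndepFun θ ξ P) (hlaw : P.map ξ = Measure.pi fun _ => μ) :
    ∫ ω, supDeviation μ (ψ (θ ω)) (ξ ω) ∂P ≤ M * (20 * D ^ 2 + 9 * D + 3) / √n := by
  have : IsProbabilityMeasure (P.map θ) := Measure.isProbabilityMeasure_map hθ.aemeasurable
  have hmeas' := measurable_supDeviation (μ := μ) hmeas hψ hn
  have hjoint : P.map (fun ω => (θ ω, ξ ω)) = (P.map θ).prod (Measure.pi fun _ => μ) := by
    rw [← hlaw]
    exact (indepFun_iff_map_prod_eq_prod_map_map hθ.aemeasurable hξ.aemeasurable).1 hind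
  have hint := integrable_supDeviation (P := (P.map θ).prod (Measure.pi fun _ : Fin n => μ))
    (μ := μ) hmeas hψ hn measurable_fst measurable_snd
  calc ∫ ω, supDeviation μ (ψ (θ ω)) (ξ ω) ∂P
      = ∫ p, supDeviation μ (ψ p.1) p.2 ∂((P.map θ).prod (Measure.pi fun _ => μ)) := by
        rw [← hjoint, integral_map (hθ.prodMk hξ).aemeasurable hmeas'.aestronglyMeasurable]
    _ = ∫ ϑ, ∫ ζ, supDeviation μ (ψ ϑ) ζ ∂(Measure.pi fun _ => μ) ∂(P.map θ) :=
        integral_prod _ hint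
    _ ≤ ∫ _, M * (20 * D ^ 2 + 9 * D + 3) / √n ∂(P.map θ) :=
        integral_mono hint.integral_prod_left (integrable_const _) fun ϑ =>
          integral_supDeviation_le hX hD hM (hψ ϑ) hn
    _ = _ := by simp

end SupDeviation

section RunIndependence

theorem indepFun_prodMk_left {Ω A B C : Type*} [MeasurableSpace Ω] [MeasurableSpace A]
    [MeasurableSpace B] [MeasurableSpace C] {P : Measure Ω} [IsProbabilityMeasure P]
    {S : Ω → A} {Y : Ω → B} {Z : Ω → C} (hS : Measurable S) (hY : Measurable Y)
    (hZ : Measurable Z) (hSYZ : IndepFun S (fun ω => (Y ω, Z ω)) P) (hYZ : IndepFun Y Z P) :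
    IndepFun (fun ω => (S ω, Y ω)) Z P := by
  have hSY : IndepFun S Y P := hSYZ.comp measurable_id measurable_fst
  rw [indepFun_iff_map_prod_eq_prod_map_map hS.aemeasurable (hY.prodMk hZ).aemeasurable] at hSYZ
  rw [indepFun_iff_map_prod_eq_prod_map_map hY.aemeasurable hZ.aemeasurable] at hYZ
  rw [indepFun_iff_map_prod_eq_prod_map_map hS.aemeasurable hY.aemeasurable] at hSY
  have : IsProbabilityMeasure (P.map S) := Measure.isProbabilityMeasure_map hS.aemeasurable
  have : IsProbabilityMeasure (P.map Y) := Measure.isProbabilityMeasure_map hY.aemeasurable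
  have : IsProbabilityMeasure (P.map Z) := Measure.isProbabilityMeasure_map hZ.aemeasurable
  rw [indepFun_iff_map_prod_eq_prod_map_map (hS.prodMk hY).aemeasurable hZ.aemeasurable]
  calc P.map (fun ω => ((S ω, Y ω), Z ω))
      = (P.map fun ω => (S ω, (Y ω, Z ω))).map MeasurableEquiv.prodAssoc.symm := by
        rw [Measure.map_map MeasurableEquiv.prodAssoc.symm.measurable (hS.prodMk (hY.prodMk hZ))]
        rfl
    _ = ((P.map S).prod (P.map Y)).prod (P.map Z) := by
        rw [hSYZ, hYZ, ← Measure.prodAssoc_prod, MeasurableEquiv.map_symm_map]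
    _ = (P.map fun ω => (S ω, Y ω)).prod (P.map Z) := by rw [hSY]

namespace Run

variable {X : Type*} [MeasurableSpace X] {α β : Measure X} {η : ℕ → ℝ} {bs m : ℕ → ℕ}
  {Ω : Type*} [MeasurableSpace Ω] {P : Measure Ω} (R : Run α β η bs m P)

/-- The points and weights in use at an iteration, in the order `x̂, p̂, ŷ, q̂`. -/
abbrev State (X : Type*) (m : ℕ) : Type _ := (Fin m → X) × (Fin m → ℝ) × (Fin m → X) × (Fin m → ℝ)

/-- The points and weights in use at iteration `t`. -/
def state (t : ℕ) (ω : Ω) : State X (m t) := (R.xhat t ω, R.phat t ω, R.yhat t ω, R.qhat t ω)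

/-- The batch from `α` drawn in iteration `t`. -/
def xbatch (t : ℕ) (ω : Ω) (j : Fin (bs t)) : X := R.x (sampleCount bs t + j) ω

/-- The batch from `β` drawn in iteration `t`. -/
def ybatch (t : ℕ) (ω : Ω) (j : Fin (bs t)) : X := R.y (sampleCount bs t + j) ω

theorem measurable_state {t : ℕ} (ht : 1 ≤ t) : Measurable (R.state t) :=
  (R.measurable_xhat t ht).prodMk ((R.measurable_phat t ht).prodMk
    ((R.measurable_yhat t ht).prodMk (R.measurable_qhat t ht)))

theorem measurable_xbatch (t : ℕ) : Measurable (R.xbatch t) :=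
  measurable_pi_lambda _ fun _ => R.measurable_x _

theorem measurable_ybatch (t : ℕ) : Measurable (R.ybatch t) :=
  measurable_pi_lambda _ fun _ => R.measurable_y _

theorem map_xbatch (t : ℕ) : P.map (R.xbatch t) = Measure.pi fun _ => α := by
  have : IsProbabilityMeasure P := R.indep_samples.isProbabilityMeasure
  have hinj : Function.Injective fun j : Fin (bs t) => (Sum.inl (sampleCount bs t + j) : ℕ ⊕ ℕ) :=
    fun _ _ h => Fin.ext (Nat.add_left_cancel (Sum.inl_injective h))
  have hmap := (iIndepFun_iff_map_fun_eq_pi_map fun j => (R.measurable_x _).aemeasurable).1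
    (R.indep_samples.precomp hinj)
  simp only [R.law_x] at hmap
  exact hmap

theorem map_ybatch (t : ℕ) : P.map (R.ybatch t) = Measure.pi fun _ => β := by
  have : IsProbabilityMeasure P := R.indep_samples.isProbabilityMeasure
  have hinj : Function.Injective fun j : Fin (bs t) => (Sum.inr (sampleCount bs t + j) : ℕ ⊕ ℕ) :=
    fun _ _ h => Fin.ext (Nat.add_left_cancel (Sum.inr_injective h))
  have hmap := (iIndepFun_iff_map_fun_eq_pi_map fun j => (R.measurable_y _).aemeasurable).1
    (R.indep_samples.precomp hinj)
  simp only [R.law_y] at hmap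
  exact hmap

theorem indepFun_ybatch_xbatch (t : ℕ) : IndepFun (R.ybatch t) (R.xbatch t) P := by
  classical
  let SY : Finset (ℕ ⊕ ℕ) :=
    Finset.univ.image fun j : Fin (bs t) => Sum.inr (sampleCount bs t + j)
  let SX : Finset (ℕ ⊕ ℕ) :=
    Finset.univ.image fun j : Fin (bs t) => Sum.inl (sampleCount bs t + j)
  have hdisj : Disjoint SY SX := by
    simp [SY, SX, Finset.disjoint_left]
  exact (R.indep_samples.indepFun_finset SY SX hdisj
      (Sum.rec R.measurable_x R.measurable_y)).comp
    (φ := fun (f : SY → X) (j : Fin (bs t)) => f ⟨Sum.inr (sampleCount bs t + j),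
      Finset.mem_image_of_mem _ (Finset.mem_univ j)⟩)
    (ψ := fun (f : SX → X) (j : Fin (bs t)) => f ⟨Sum.inl (sampleCount bs t + j),
      Finset.mem_image_of_mem _ (Finset.mem_univ j)⟩)
    (measurable_pi_lambda _ fun _ => measurable_pi_apply _)
    (measurable_pi_lambda _ fun _ => measurable_pi_apply _)

theorem indepFun_state_batches {t : ℕ} (ht : 1 ≤ t) :
    IndepFun (R.state t) (fun ω => (R.ybatch t ω, R.xbatch t ω)) P :=
  (R.nonanticipating t ht).comp measurable_id
    (ψ := fun f : ℕ → X × X => ((fun j : Fin (bs t) => (f j).2), (fun j : Fin (bs t) => (f j).1)))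
    ((measurable_pi_lambda _ fun _ => (measurable_pi_apply _).snd).prodMk
      (measurable_pi_lambda _ fun _ => (measurable_pi_apply _).fst))

theorem indepFun_state_ybatch {t : ℕ} (ht : 1 ≤ t) : IndepFun (R.state t) (R.ybatch t) P :=
  (R.indepFun_state_batches ht).comp measurable_id measurable_fst

theorem indepFun_state_ybatch_xbatch {t : ℕ} (ht : 1 ≤ t) :
    IndepFun (fun ω => (R.state t ω, R.ybatch t ω)) (R.xbatch t) P :=
  have : IsProbabilityMeasure P := R.indep_samples.isProbabilityMeasure
  indepFun_prodMk_left (R.measurable_state ht) (R.measurable_ybatch t) (R.measurable_xbatch t)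
    (R.indepFun_state_batches ht) (R.indepFun_ybatch_xbatch t)

end Run

end RunIndependence

section RatioLE

variable {X : Type*} {u v : X → ℝ} {R R' : ℝ}

/-- The values of `u` differ by a factor of at most `R`. For positive `u` this says that
`log u` has oscillation at most `log R`. -/
def RatioLE (u : X → ℝ) (R : ℝ) : Prop := ∀ x x', u x ≤ R * u x'

theorem RatioLE.mono (h : RatioLE u R) (hu : ∀ x, 0 ≤ u x) (hR : R ≤ R') : RatioLE u R' :=
  fun x x' => (h x x').trans (mul_le_mul_of_nonneg_right hR (hu x'))

theorem RatioLE.inv (h : RatioLE u R) (hu : ∀ x, 0 < u x) : RatioLE (fun x => (u x)⁻¹) R :=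
  fun x x' => by
    simp only [← one_div]
    rw [mul_one_div, div_le_div_iff₀ (hu x) (hu x'), one_mul]
    exact h x' x

theorem RatioLE.add (h : RatioLE u R) (h' : RatioLE v R) : RatioLE (fun x => u x + v x) R :=
  fun x x' => (add_le_add (h x x') (h' x x')).trans_eq (mul_add _ _ _).symm

theorem RatioLE.const_mul (h : RatioLE u R) {c : ℝ} (hc : 0 ≤ c) :
    RatioLE (fun x => c * u x) R := fun x x' =>
  (mul_le_mul_of_nonneg_left (h x x') hc).trans_eq (mul_left_comm _ _ _)

theorem RatioLE.sum {ι : Type*} {S : Finset ι} {u : ι → X → ℝ} (h : ∀ i ∈ S, RatioLE (u i) R) :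
    RatioLE (fun x => ∑ i ∈ S, u i x) R := fun x x' => by
  rw [Finset.mul_sum]
  exact Finset.sum_le_sum fun i hi => h i hi x x'

theorem RatioLE.of_perturbation {δ Q : ℝ} (hR : RatioLE u R) (hQ : RatioLE u Q)
    (hv : ∀ x, 0 < v x) (hδ : 0 ≤ δ)
    (hle : ∀ x, v x ≤ Real.exp δ * u x) (hge : ∀ x, u x ≤ Real.exp δ * v x) :
    RatioLE v (R + (Real.exp (2 * δ) - 1) * Q) := by
  intro x x'
  have hexp : 1 ≤ Real.exp (2 * δ) := Real.one_le_exp (by linarith)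
  have hu : ∀ x, 0 < u x := fun x => pos_of_mul_pos_right ((hv x).trans_le (hle x)) (by positivity)
  have hmin : RatioLE u (min R Q) := by
    rcases min_choice R Q with h | h <;> rw [h] <;> assumption
  have hmin0 : 0 ≤ min R Q := (pos_of_mul_pos_left ((hu x).trans_le (hmin x x)) (hu x).le).le
  calc v x ≤ Real.exp δ * (min R Q * u x') := (hle x).trans (by gcongr; exact hmin x x')
    _ ≤ Real.exp δ * (min R Q * (Real.exp δ * v x')) := by gcongr; exact hge x'
    _ = (min R Q + (Real.exp (2 * δ) - 1) * min R Q) * v x' := by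
        rw [two_mul, Real.exp_add]; ring
    _ ≤ (R + (Real.exp (2 * δ) - 1) * Q) * v x' := by
        refine mul_le_mul_of_nonneg_right (add_le_add (min_le_left _ _) ?_) (hv x').le
        exact mul_le_mul_of_nonneg_left (min_le_right _ _) (by linarith)

end RatioLE

section MarkovDensity

variable {X Y : Type*} [MeasurableSpace Y] {μ : Measure Y} {p : X → Y → ℝ} {h : Y → ℝ} {κ M : ℝ}

/-- `p x` is, for every `x`, a probability density with respect to `μ`, with all values in
`[κ, κ⁻¹]`. -/
structure IsMarkovDensity (μ : Measure Y) (p : X → Y → ℝ) (κ : ℝ) : Prop where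
  pos : 0 < κ
  measurable : ∀ x, Measurable (p x)
  le : ∀ x y, κ ≤ p x y
  le_inv : ∀ x y, p x y ≤ κ⁻¹
  integral_eq_one : ∀ x, ∫ y, p x y ∂μ = 1

namespace IsMarkovDensity

theorem ratioLE (hp : IsMarkovDensity μ p κ) (y : Y) : RatioLE (fun x => p x y) (κ⁻¹ ^ 2) :=
  fun x x' => by
    have := mul_le_mul_of_nonneg_left (hp.le x' y) (sq_nonneg κ⁻¹)
    have hκ := hp.pos.ne'
    calc p x y ≤ κ⁻¹ := hp.le_inv x y
      _ = κ⁻¹ ^ 2 * κ := by field_simp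
      _ ≤ κ⁻¹ ^ 2 * p x' y := this

theorem integrable [IsFiniteMeasure μ] (hp : IsMarkovDensity μ p κ) (x : X) :
    Integrable (p x) μ :=
  .of_bound (hp.measurable x).aestronglyMeasurable κ⁻¹ (Filter.Eventually.of_forall fun y => by
    rw [Real.norm_of_nonneg (hp.pos.le.trans (hp.le x y))]
    exact hp.le_inv x y)

theorem le_one [IsProbabilityMeasure μ] [Nonempty X] (hp : IsMarkovDensity μ p κ) : κ ≤ 1 := by
  obtain ⟨x⟩ := ‹Nonempty X›
  simpa [hp.integral_eq_one] using integral_mono (integrable_const κ) (hp.integrable x) (hp.le x)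

theorem integrable_mul (hp : IsMarkovDensity μ p κ) (hh : Integrable h μ) (x : X) :
    Integrable (fun y => p x y * h y) μ :=
  hh.bdd_mul (hp.measurable x).aestronglyMeasurable (Filter.Eventually.of_forall fun y => by
    rw [Real.norm_of_nonneg (hp.pos.le.trans (hp.le x y))]
    exact hp.le_inv x y)

theorem integral_mul_le [IsProbabilityMeasure μ] (hp : IsMarkovDensity μ p κ)
    (hh : Integrable h μ) {c : ℝ} (hc : ∀ y, h y ≤ c) (x : X) :
    ∫ y, p x y * h y ∂μ ≤ κ * ∫ y, h y ∂μ + (1 - κ) * c := by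
  have hrest : Integrable (fun y => (p x y - κ) * c) μ :=
    ((hp.integrable x).sub (integrable_const κ)).mul_const c
  calc ∫ y, p x y * h y ∂μ ≤ ∫ y, (κ * h y + (p x y - κ) * c) ∂μ :=
        integral_mono (hp.integrable_mul hh x) ((hh.const_mul κ).add hrest) fun y => by
          linarith [mul_le_mul_of_nonneg_left (hc y) (sub_nonneg.2 (hp.le x y))]
    _ = κ * ∫ y, h y ∂μ + (1 - κ) * c := by
        rw [integral_add (hh.const_mul κ) hrest, integral_const_mul, integral_mul_const,
          integral_sub (hp.integrable x) (integrable_const κ), hp.integral_eq_one]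
        simp

theorem le_integral_mul [IsProbabilityMeasure μ] (hp : IsMarkovDensity μ p κ)
    (hh : Integrable h μ) {c : ℝ} (hc : ∀ y, c ≤ h y) (x : X) :
    κ * ∫ y, h y ∂μ + (1 - κ) * c ≤ ∫ y, p x y * h y ∂μ := by
  have := hp.integral_mul_le hh.neg (fun y => neg_le_neg (hc y)) x
  simp only [Pi.neg_apply, mul_neg, integral_neg] at this
  linarith

theorem ratioLE_integral [IsProbabilityMeasure μ] (hp : IsMarkovDensity μ p κ)
    (hm : Measurable h) (hh : ∀ y, 0 < h y) (hM : 0 ≤ M) (hr : RatioLE h (1 + M)) :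
    RatioLE (fun x => ∫ y, p x y * h y ∂μ) (1 + (1 - κ) * M) := by
  intro x x'
  have : Nonempty X := ⟨x⟩
  have : Nonempty Y := nonempty_of_isProbabilityMeasure μ
  set m := ⨅ y, h y
  have m_le : ∀ y, m ≤ h y := ciInf_le ⟨0, Set.forall_mem_range.2 fun y => (hh y).le⟩
  have le_m : ∀ y, h y ≤ (1 + M) * m := fun y => by
    rw [← div_le_iff₀' (by linarith)]
    refine le_ciInf fun y' => ?_
    rw [div_le_iff₀' (by linarith)]
    exact hr y y'
  have hint : Integrable h μ := .of_bound hm.aestronglyMeasurable ((1 + M) * m)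
    (Filter.Eventually.of_forall fun y => by rw [Real.norm_of_nonneg (hh y).le]; exact le_m y)
  have m_le_mean : m ≤ ∫ y, h y ∂μ := by
    simpa using integral_mono (integrable_const m) hint m_le
  have hκM : 0 ≤ (1 - κ) * M := mul_nonneg (sub_nonneg.2 hp.le_one) hM
  -- The part `κ` of the density adds the same amount to all averages, and that is at least `κ * m`.
  calc _ ≤ κ * ∫ y, h y ∂μ + (1 - κ) * ((1 + M) * m) := hp.integral_mul_le hint le_m x
    _ ≤ (1 + (1 - κ) * M) * (κ * ∫ y, h y ∂μ + (1 - κ) * m) := by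
        nlinarith [mul_le_mul_of_nonneg_left m_le_mean (mul_nonneg hκM hp.pos.le)]
    _ ≤ _ := by gcongr; exact hp.le_integral_mul hint m_le x'

end IsMarkovDensity

end MarkovDensity


section SinkhornUpdate

variable {X Y : Type*} {p : X → Y → ℝ} {U : X → ℝ} {V : Y → ℝ} {n : ℕ} {ξ : Fin n → Y}
  {η κ B M : ℝ}

/-- The online Sinkhorn half-step for scalings taken relative to the optimal ones. -/
def sinkhornUpdate (η : ℝ) (p : X → Y → ℝ) (U : X → ℝ) (V : Y → ℝ) (ξ : Fin n → Y) (x : X) : ℝ :=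
  (1 - η) * U x + η * ((∑ j, p x (ξ j) / V (ξ j)) / n)

/-- The products `U x * V y` lie in `[B⁻¹, B]`. Sinkhorn iterations are invariant under
`(U, V) ↦ (r U, r⁻¹ V)`, and this is the bound on the size of a pair that respects it. -/
def HasScale (U : X → ℝ) (V : Y → ℝ) (B : ℝ) : Prop := ∀ x y, B⁻¹ ≤ U x * V y ∧ U x * V y ≤ B

theorem HasScale.symm (h : HasScale U V B) : HasScale V U B := fun y x => by
  rw [mul_comm]
  exact h x y

theorem HasScale.mono {B' : ℝ} (h : HasScale U V B) (hB : 0 < B) (hBB' : B ≤ B') :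
    HasScale U V B' := fun x y =>
  ⟨(inv_anti₀ hB hBB').trans (h x y).1, (h x y).2.trans hBB'⟩

theorem HasScale.of_perturbation {U' : X → ℝ} {V' : Y → ℝ} {δ : ℝ} (h : HasScale U V B)
    (hU' : ∀ x, 0 < U' x) (hV : ∀ y, 0 < V y)
    (hU : ∀ x, U' x ≤ Real.exp δ * U x ∧ U x ≤ Real.exp δ * U' x)
    (hV' : ∀ y, V' y ≤ Real.exp δ * V y ∧ V y ≤ Real.exp δ * V' y) :
    HasScale U' V' (Real.exp (2 * δ) * B) := by
  intro x y
  have hexp : Real.exp (2 * δ) = Real.exp δ * Real.exp δ := by rw [two_mul, Real.exp_add]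
  constructor
  · rw [mul_inv, ← div_eq_inv_mul, div_le_iff₀ (Real.exp_pos _)]
    calc B⁻¹ ≤ U x * V y := (h x y).1
      _ ≤ (Real.exp δ * U' x) * (Real.exp δ * V' y) :=
        mul_le_mul (hU x).2 (hV' y).2 (hV y).le (mul_nonneg (Real.exp_pos _).le (hU' x).le)
      _ = U' x * V' y * Real.exp (2 * δ) := by rw [hexp]; ring
  · have hV0 : 0 ≤ V' y := (pos_of_mul_pos_right ((hV y).trans_le (hV' y).2) (by positivity)).le
    calc U' x * V' y ≤ (Real.exp δ * U x) * (Real.exp δ * V y) :=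
        mul_le_mul (hU x).1 (hV' y).1 hV0 ((hU' x).le.trans (hU x).1)
      _ = Real.exp (2 * δ) * (U x * V y) := by rw [hexp]; ring
      _ ≤ _ := by gcongr; exact (h x y).2

/-- A pair of positive scalings such as the Sinkhorn iterations produce: their ratios are as bounded
as those of the density, and they have scale `B`. -/
structure IsScalingPair (κ B : ℝ) (U : X → ℝ) (V : Y → ℝ) : Prop where
  pos_left : ∀ x, 0 < U x
  pos_right : ∀ y, 0 < V y
  ratioLE_left : RatioLE U (κ⁻¹ ^ 2)
  ratioLE_right : RatioLE V (κ⁻¹ ^ 2)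
  hasScale : HasScale U V B

theorem IsScalingPair.symm (h : IsScalingPair κ B U V) : IsScalingPair κ B V U :=
  ⟨h.pos_right, h.pos_left, h.ratioLE_right, h.ratioLE_left, h.hasScale.symm⟩

variable [MeasurableSpace Y] {μ : Measure Y}

theorem IsMarkovDensity.mul_div_mem_Icc (hp : IsMarkovDensity μ p κ) (hV : ∀ y, 0 < V y)
    (hVr : RatioLE V (κ⁻¹ ^ 2)) (x : X) (y z : Y) :
    κ ^ 3 ≤ V y * (p x z / V z) ∧ V y * (p x z / V z) ≤ κ⁻¹ ^ 3 := by
  have hκ := hp.pos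
  have hratio : κ ^ 2 ≤ V y / V z ∧ V y / V z ≤ κ⁻¹ ^ 2 := by
    refine ⟨?_, (div_le_iff₀ (hV z)).2 (hVr y z)⟩
    rw [le_div_iff₀ (hV z), ← le_div_iff₀' (by positivity), div_eq_inv_mul, ← inv_pow]
    exact hVr z y
  rw [mul_div_left_comm]
  have hle := hp.le x z
  exact ⟨(pow_succ' κ 2).trans_le (mul_le_mul hle hratio.1 (by positivity) (hκ.le.trans hle)),
    (mul_le_mul (hp.le_inv x z) hratio.2 (div_pos (hV y) (hV z)).le (by positivity)).trans_eq
      (pow_succ' κ⁻¹ 2).symm⟩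

theorem IsMarkovDensity.mul_average_mem_Icc (hp : IsMarkovDensity μ p κ) (hV : ∀ y, 0 < V y)
    (hVr : RatioLE V (κ⁻¹ ^ 2)) (hn : 1 ≤ n) (ξ : Fin n → Y) (x : X) (y : Y) :
    κ ^ 3 ≤ V y * ((∑ j, p x (ξ j) / V (ξ j)) / n) ∧
      V y * ((∑ j, p x (ξ j) / V (ξ j)) / n) ≤ κ⁻¹ ^ 3 := by
  have hn' : (0 : ℝ) < n := by exact_mod_cast hn
  have hmem := fun j => hp.mul_div_mem_Icc hV hVr x y (ξ j)
  rw [mul_div_assoc', le_div_iff₀ hn', div_le_iff₀ hn', Finset.mul_sum]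
  constructor
  · simpa [mul_comm] using Finset.card_nsmul_le_sum Finset.univ _ _ fun j _ => (hmem j).1
  · simpa [mul_comm] using Finset.sum_le_card_nsmul Finset.univ _ _ fun j _ => (hmem j).2

theorem sinkhornUpdate_pos (hp : IsMarkovDensity μ p κ) (hU : ∀ x, 0 < U x) (hV : ∀ y, 0 < V y)
    (hη₀ : 0 ≤ η) (hη₁ : η ≤ 1) (hn : 1 ≤ n) (x : X) : 0 < sinkhornUpdate η p U V ξ x := by
  have : NeZero n := ⟨by positivity⟩
  have hT : 0 < (∑ j, p x (ξ j) / V (ξ j)) / n :=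
    div_pos (Finset.sum_pos (fun j _ => div_pos (hp.pos.trans_le (hp.le _ _)) (hV _))
      Finset.univ_nonempty) (by positivity)
  rcases hη₀.eq_or_lt with rfl | hη
  · simpa [sinkhornUpdate] using hU x
  · exact add_pos_of_nonneg_of_pos (mul_nonneg (by linarith) (hU x).le) (mul_pos hη hT)

theorem ratioLE_sinkhornUpdate (hp : IsMarkovDensity μ p κ) (hU : RatioLE U (κ⁻¹ ^ 2))
    (hV : ∀ y, 0 < V y) (hη₀ : 0 ≤ η) (hη₁ : η ≤ 1) :
    RatioLE (sinkhornUpdate η p U V ξ) (κ⁻¹ ^ 2) := by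
  refine (hU.const_mul (by linarith)).add (RatioLE.const_mul ?_ hη₀)
  simp only [div_eq_inv_mul]
  exact (RatioLE.sum fun j _ => (hp.ratioLE (ξ j)).const_mul (inv_nonneg.2 (hV _).le)).const_mul
    (inv_nonneg.2 n.cast_nonneg)

theorem HasScale.sinkhornUpdate (hp : IsMarkovDensity μ p κ) (h : HasScale U V B)
    (hB : κ⁻¹ ^ 3 ≤ B) (hV : ∀ y, 0 < V y) (hVr : RatioLE V (κ⁻¹ ^ 2))
    (hη₀ : 0 ≤ η) (hη₁ : η ≤ 1) (hn : 1 ≤ n) : HasScale (sinkhornUpdate η p U V ξ) V B := by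
  intro x y
  have hκ := hp.pos
  obtain ⟨lower, upper⟩ := hp.mul_average_mem_Icc hV hVr hn ξ x y
  have lower' : B⁻¹ ≤ κ ^ 3 := by
    rw [inv_pow] at hB
    exact inv_le_of_inv_le₀ (by positivity) hB
  have convex : COS.sinkhornUpdate η p U V ξ x * V y
      = (1 - η) * (U x * V y) + η * (V y * ((∑ j, p x (ξ j) / V (ξ j)) / n)) := by
    rw [COS.sinkhornUpdate]; ring
  rw [convex]
  have hη' : 0 ≤ 1 - η := by linarith
  constructor
  · linarith [mul_le_mul_of_nonneg_left (h x y).1 hη',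
      mul_le_mul_of_nonneg_left (lower'.trans lower) hη₀]
  · linarith [mul_le_mul_of_nonneg_left (h x y).2 hη',
      mul_le_mul_of_nonneg_left (upper.trans hB) hη₀]

theorem IsScalingPair.sinkhornUpdate (hp : IsMarkovDensity μ p κ) (h : IsScalingPair κ B U V)
    (hB : κ⁻¹ ^ 3 ≤ B) (hη₀ : 0 ≤ η) (hη₁ : η ≤ 1) (hn : 1 ≤ n) :
    IsScalingPair κ B (sinkhornUpdate η p U V ξ) V where
  pos_left := sinkhornUpdate_pos hp h.pos_left h.pos_right hη₀ hη₁ hn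
  pos_right := h.pos_right
  ratioLE_left := ratioLE_sinkhornUpdate hp h.ratioLE_left h.pos_right hη₀ hη₁
  ratioLE_right := h.ratioLE_right
  hasScale := h.hasScale.sinkhornUpdate hp hB h.pos_right h.ratioLE_right hη₀ hη₁ hn

/-- How much of the excess `M` of the ratios over `1` a half-step removes, per unit of `η`. -/
def contractionRate (κ B : ℝ) : ℝ := κ ^ 4 / B

/-- How much the sampling error contributes to the ratios in a half-step, per unit of `η`. -/
def noiseGain (κ B : ℝ) : ℝ := (2 + κ⁻¹ ^ 2) * B

theorem empiricalDeviation_mul_div (φ : Y → ℝ) (y₀ : Y) :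
    empiricalDeviation μ (fun y => φ y * (V y₀ / V y)) ξ
      = ((∑ j, φ (ξ j) / V (ξ j)) / n - ∫ y, φ y * (V y)⁻¹ ∂μ) * V y₀ := by
  have weight : ∀ y, φ y * (V y₀ / V y) = φ y * (V y)⁻¹ * V y₀ := fun y => by ring
  simp only [empiricalDeviation, weight, ← Finset.sum_mul, integral_mul_const,
    div_eq_mul_inv (φ _)]
  ring

theorem IsScalingPair.contractionRate_mul_le (hp : IsMarkovDensity μ p κ)
    (h : IsScalingPair κ B U V) (hB : 0 < B) (hn : 1 ≤ n) (ξ : Fin n → Y) (y₀ : Y) (x : X) :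
    contractionRate κ B * U x ≤ κ * ((∑ j, p x (ξ j) / V (ξ j)) / n) := by
  have hκ := hp.pos
  rw [contractionRate, div_mul_eq_mul_div, div_le_iff₀ hB]
  refine le_of_mul_le_mul_right ?_ (h.pos_right y₀)
  linarith [mul_le_mul_of_nonneg_left (h.hasScale x y₀).2 (pow_pos hκ 4).le,
    mul_le_mul_of_nonneg_left (hp.mul_average_mem_Icc h.pos_right h.ratioLE_right hn ξ x y₀).1
      (mul_pos hκ hB).le]

theorem le_contraction_add_of_abs_sub_le {T T' q q' d : ℝ} (hκ₀ : 0 < κ) (hκ₁ : κ ≤ 1)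
    (hM₀ : 0 ≤ M) (hM₁ : M ≤ κ⁻¹ ^ 2) (hT : |T - q| ≤ d) (hT' : |T' - q'| ≤ d)
    (hq : q ≤ (1 + (1 - κ) * M) * q') :
    T ≤ (1 + M) * T' - M * (κ * T') + (2 + κ⁻¹ ^ 2) * d := by
  have hd : 0 ≤ d := (abs_nonneg _).trans hT
  have hκM : 0 ≤ (1 - κ) * M := mul_nonneg (sub_nonneg.2 hκ₁) hM₀
  have hmul : (1 - κ) * M * d ≤ κ⁻¹ ^ 2 * d := by gcongr; nlinarith
  linarith [(abs_le.1 hT).2,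
    mul_le_mul_of_nonneg_left (abs_le.1 hT').1 (by linarith : 0 ≤ 1 + (1 - κ) * M)]

theorem IsScalingPair.ratioLE_sinkhornUpdate [IsProbabilityMeasure μ]
    (hp : IsMarkovDensity μ p κ) (h : IsScalingPair κ B U V) (hB : κ⁻¹ ^ 3 ≤ B)
    (hη₀ : 0 ≤ η) (hη₁ : η ≤ 1) (hn : 1 ≤ n) (hVm : Measurable V)
    (hU : RatioLE U (1 + M)) (hV : RatioLE V (1 + M)) (hM₀ : 0 ≤ M) (hM₁ : M ≤ κ⁻¹ ^ 2)
    {e : ℝ} {y₀ : Y} (he : ∀ x, |empiricalDeviation μ (fun y => p x y * (V y₀ / V y)) ξ| ≤ e) :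
    RatioLE (COS.sinkhornUpdate η p U V ξ)
      (1 + (M * (1 - η * contractionRate κ B) + η * noiseGain κ B * e)) := by
  intro x x'
  have hκ := hp.pos
  have hB₀ : 0 < B := lt_of_lt_of_le (by positivity) hB
  have h' := h.sinkhornUpdate (ξ := ξ) hp hB hη₀ hη₁ hn
  set T : X → ℝ := fun x => (∑ j, p x (ξ j) / V (ξ j)) / n
  set q : X → ℝ := fun x => ∫ y, p x y * (V y)⁻¹ ∂μ
  set U' := COS.sinkhornUpdate η p U V ξ
  set d := e / V y₀
  have hdev : ∀ x, |T x - q x| ≤ d := fun x => by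
    rw [le_div_iff₀ (h.pos_right y₀), ← abs_of_pos (h.pos_right y₀), ← abs_mul,
      ← empiricalDeviation_mul_div]
    exact he x
  have hd : d ≤ e * B * U' x' := by
    have he₀ : 0 ≤ e := (abs_nonneg _).trans (he x)
    have : 1 ≤ U' x' * V y₀ * B := by
      simpa [hB₀.ne'] using mul_le_mul_of_nonneg_right (h'.hasScale x' y₀).1 hB₀.le
    rw [div_le_iff₀ (h.pos_right y₀)]
    nlinarith
  have hq : q x ≤ (1 + (1 - κ) * M) * q x' :=
    hp.ratioLE_integral hVm.inv (fun y => inv_pos.2 (h.pos_right y)) hM₀ (hV.inv h.pos_right) x x'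
  have : Nonempty X := ⟨x⟩
  have hTx : T x ≤ (1 + M) * T x' - M * (κ * T x') + (2 + κ⁻¹ ^ 2) * d :=
    le_contraction_add_of_abs_sub_le hκ hp.le_one hM₀ hM₁ (hdev x) (hdev x') hq
  have hTx' : contractionRate κ B * U' x' ≤ κ * T x' :=
    h'.contractionRate_mul_le hp hB₀ hn ξ y₀ x'
  calc U' x = (1 - η) * U x + η * T x := rfl
    _ ≤ (1 - η) * ((1 + M) * U x')
        + η * ((1 + M) * T x' - M * (κ * T x') + (2 + κ⁻¹ ^ 2) * d) := by
        have := sub_nonneg.2 hη₁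
        gcongr
        exact hU x x'
    _ = (1 + M) * U' x' - η * M * (κ * T x') + η * (2 + κ⁻¹ ^ 2) * d := by
        simp only [U', COS.sinkhornUpdate, T]; ring
    _ ≤ (1 + M) * U' x' - η * M * (contractionRate κ B * U' x')
        + η * (2 + κ⁻¹ ^ 2) * (e * B * U' x') := by
        gcongr
    _ = _ := by rw [noiseGain]; ring

theorem contractionRate_le_one (hκ₀ : 0 < κ) (hκ₁ : κ ≤ 1) (hB : κ⁻¹ ^ 3 ≤ B) :
    contractionRate κ B ≤ 1 :=
  (div_le_one₀ (lt_of_lt_of_le (by positivity) hB)).2 <|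
    (pow_le_one₀ hκ₀.le hκ₁).trans ((one_le_pow₀ ((one_le_inv₀ hκ₀).2 hκ₁)).trans hB)

theorem IsScalingPair.ratioLE_sinkhornUpdate_sinkhornUpdate [MeasurableSpace X] {ν : Measure X}
    [IsProbabilityMeasure μ] [IsProbabilityMeasure ν] {q : Y → X → ℝ} {ξ' : Fin n → X}
    (hp : IsMarkovDensity μ p κ) (hq : IsMarkovDensity ν q κ) (h : IsScalingPair κ B U V)
    (hB : κ⁻¹ ^ 3 ≤ B) (hη₀ : 0 ≤ η) (hη₁ : η ≤ 1) (hn : 1 ≤ n) (hVm : Measurable V)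
    {U' : X → ℝ} (hU' : U' = COS.sinkhornUpdate η p U V ξ) (hUm : Measurable U')
    (hU : RatioLE U (1 + M)) (hV : RatioLE V (1 + M)) (hM₀ : 0 ≤ M) (hM₁ : M ≤ κ⁻¹ ^ 2)
    {e e' : ℝ} {x₀ : X} {y₀ : Y}
    (he : ∀ x, |empiricalDeviation μ (fun y => p x y * (V y₀ / V y)) ξ| ≤ e)
    (he' : ∀ y, |empiricalDeviation ν (fun x => q y x * (U' x₀ / U' x)) ξ'| ≤ e') :
    RatioLE U'
        (1 + (M * (1 - η * contractionRate κ B) + η * noiseGain κ B * (e + e'))) ∧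
      RatioLE (COS.sinkhornUpdate η q V U' ξ')
        (1 + (M * (1 - η * contractionRate κ B) + η * noiseGain κ B * (e + e'))) := by
  have hκ := hp.pos
  have : Nonempty X := ⟨x₀⟩
  have hB₀ : 0 < B := lt_of_lt_of_le (by positivity) hB
  have he₀ : 0 ≤ e := (abs_nonneg _).trans (he x₀)
  have he₀' : 0 ≤ e' := (abs_nonneg _).trans (he' y₀)
  have hG : 0 ≤ η * noiseGain κ B := mul_nonneg hη₀ (by rw [noiseGain]; positivity)
  have hrη : 0 ≤ η * contractionRate κ B := mul_nonneg hη₀ (by rw [contractionRate]; positivity)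
  have hrη₁ : η * contractionRate κ B ≤ 1 :=
    (mul_le_of_le_one_right hη₀ (contractionRate_le_one hκ hp.le_one hB)).trans hη₁
  have hpair : IsScalingPair κ B U' V := hU' ▸ h.sinkhornUpdate hp hB hη₀ hη₁ hn
  have hleft := h.ratioLE_sinkhornUpdate hp hB hη₀ hη₁ hn hVm hU hV hM₀ hM₁ he
  rw [← hU'] at hleft
  refine ⟨hleft.mono (fun x => (hpair.pos_left x).le) (by nlinarith), ?_⟩
  -- The second half-step starts from a possibly larger excess, which is still at most `κ⁻²`.
  set M' := min (M + η * noiseGain κ B * e) (κ⁻¹ ^ 2)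
  have hM' : M' ≤ M + η * noiseGain κ B * e := min_le_left _ _
  have hMM' : M ≤ M' := le_min (by nlinarith) hM₁
  have hU'M' : RatioLE U' (1 + M') := by
    rcases min_choice (M + η * noiseGain κ B * e) (κ⁻¹ ^ 2) with hmin | hmin
    · exact hleft.mono (fun x => (hpair.pos_left x).le) (by simp only [M', hmin]; nlinarith)
    · exact hpair.ratioLE_left.mono (fun x => (hpair.pos_left x).le)
        (by simp only [M', hmin]; linarith)
  have hVM' := hV.mono (fun y => (hpair.pos_right y).le) (by linarith : 1 + M ≤ 1 + M')
  refine (hpair.symm.ratioLE_sinkhornUpdate hq hB hη₀ hη₁ hn hUm hVM' hU'M' (hM₀.trans hMM')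
    (min_le_right _ _) he').mono
    (fun y => ((hpair.symm.sinkhornUpdate hq hB hη₀ hη₁ hn).pos_left y).le) ?_
  nlinarith [mul_le_mul_of_nonneg_right hM' (sub_nonneg.2 hrη₁), mul_nonneg hG he₀]

end SinkhornUpdate

section Potentials

variable {X : Type*} {ε : ℝ} {C : X → X → ℝ} {fs gs f f' h : X → ℝ} {m n : ℕ} {w : Fin m → ℝ}
  {z : Fin m → X} {ξ : Fin n → X} {η κ δ : ℝ}

/-- The scaling `exp (-f / ε)` relative to that of the reference potential `fs`. -/
def relScaling (ε : ℝ) (fs f : X → ℝ) (x : X) : ℝ := Real.exp ((fs x - f x) / ε)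

/-- The density, with respect to `α ⊗ β`, of the transport plan with potentials `fs`, `gs`. -/
def planDensity (ε : ℝ) (C : X → X → ℝ) (fs gs : X → ℝ) (x y : X) : ℝ :=
  Real.exp ((fs x + gs y - C x y) / ε)

theorem relScaling_pos (x : X) : 0 < relScaling ε fs f x := Real.exp_pos _

theorem relScaling_neg_mul_log {S : ℝ} {x : X} (hε : ε ≠ 0) (hS : 0 < S)
    (hf : f x = -ε * Real.log S) : relScaling ε fs f x = Real.exp (fs x / ε) * S := by
  have : (fs x - f x) / ε = fs x / ε + Real.log S := by rw [hf]; field_simp; ring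
  rw [relScaling, this, Real.exp_add, Real.exp_log hS]

theorem exp_div_mul_exp_sub_div (fs gs : X → ℝ) (v : ℝ) (x y : X) :
    Real.exp (fs x / ε) * Real.exp ((v - C x y) / ε)
      = planDensity ε C fs gs x y * Real.exp ((v - gs y) / ε) := by
  rw [planDensity, ← Real.exp_add, ← Real.exp_add]
  ring_nf

theorem relScaling_atomicPotential (hε : ε ≠ 0) (hm : 1 ≤ m) (gs : X → ℝ) (x : X) :
    relScaling ε fs (atomicPotential ε C w z) x
      = ∑ i, planDensity ε C fs gs x (z i) * Real.exp ((w i - gs (z i)) / ε) := by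
  have : NeZero m := ⟨by positivity⟩
  have hpos : 0 < ∑ i, Real.exp ((w i - C x (z i)) / ε) :=
    Finset.sum_pos (fun i _ => Real.exp_pos _) Finset.univ_nonempty
  rw [relScaling_neg_mul_log (f := atomicPotential ε C w z) hε hpos rfl, Finset.mul_sum]
  simp only [exp_div_mul_exp_sub_div fs gs]

theorem relScaling_onlineUpdate (hε : ε ≠ 0) (hη₀ : 0 ≤ η) (hη₁ : η ≤ 1) (hm : 1 ≤ m)
    (hn : 1 ≤ n) :
    relScaling ε fs (onlineUpdate ε C η w z h ξ)
      = sinkhornUpdate η (planDensity ε C fs gs) (relScaling ε fs (atomicPotential ε C w z))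
          (relScaling ε gs h) ξ := by
  ext x
  have : NeZero m := ⟨by positivity⟩
  have : NeZero n := ⟨by positivity⟩
  have hold : 0 < ∑ i, Real.exp ((w i - C x (z i)) / ε) :=
    Finset.sum_pos (fun i _ => Real.exp_pos _) Finset.univ_nonempty
  have hnew : 0 < ∑ j, Real.exp ((h (ξ j) - C x (ξ j)) / ε) :=
    Finset.sum_pos (fun i _ => Real.exp_pos _) Finset.univ_nonempty
  have hn₀ : (0 : ℝ) < n := by exact_mod_cast hn
  have hpos : 0 < (∑ i, (1 - η) * Real.exp ((w i - C x (z i)) / ε))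
      + ∑ j, (η / n) * Real.exp ((h (ξ j) - C x (ξ j)) / ε) := by
    rw [← Finset.mul_sum, ← Finset.mul_sum]
    rcases hη₀.eq_or_lt with rfl | hη
    · simpa using hold
    · exact add_pos_of_nonneg_of_pos (mul_nonneg (by linarith) hold.le)
        (mul_pos (div_pos hη hn₀) hnew)
  have hinv : ∀ y, Real.exp ((h y - gs y) / ε) = (relScaling ε gs h y)⁻¹ := fun y => by
    rw [relScaling, ← Real.exp_neg]; ring_nf
  rw [relScaling_neg_mul_log (f := onlineUpdate ε C η w z h ξ) hε hpos rfl, sinkhornUpdate,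
    relScaling_neg_mul_log (f := atomicPotential ε C w z) hε hold rfl,
    mul_add, ← Finset.mul_sum, ← Finset.mul_sum]
  simp only [div_eq_mul_inv (planDensity _ _ _ _ _ _), ← hinv,
    ← exp_div_mul_exp_sub_div fs gs, ← Finset.mul_sum]
  ring

theorem ratioLE_relScaling_atomicPotential [MeasurableSpace X] {μ : Measure X}
    (hp : IsMarkovDensity μ (planDensity ε C fs gs) κ) (hε : ε ≠ 0) (hm : 1 ≤ m) :
    RatioLE (relScaling ε fs (atomicPotential ε C w z)) (κ⁻¹ ^ 2) := by
  have : relScaling ε fs (atomicPotential ε C w z) = fun x =>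
      ∑ i, Real.exp ((w i - gs (z i)) / ε) * planDensity ε C fs gs x (z i) := by
    ext x
    simp only [relScaling_atomicPotential hε hm gs, mul_comm]
  rw [this]
  exact RatioLE.sum fun i _ => (hp.ratioLE (z i)).const_mul (Real.exp_pos _).le

theorem relScaling_le_of_abs_sub_le (hε : 0 < ε) {x : X} (h : |f x - f' x| ≤ ε * δ) :
    relScaling ε fs f' x ≤ Real.exp δ * relScaling ε fs f x ∧
      relScaling ε fs f x ≤ Real.exp δ * relScaling ε fs f' x := by
  obtain ⟨hl, hu⟩ := abs_le.1 h
  simp only [relScaling, ← Real.exp_add, Real.exp_le_exp]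
  constructor <;> rw [div_le_iff₀ hε, add_mul, div_mul_cancel₀ _ hε.ne'] <;> linarith

theorem hasScale_relScaling_atomicPotential_zero {x₀ y₀ : Fin m → X} {F : ℝ} (hε : ε ≠ 0)
    (hm : 1 ≤ m) (hf : ∀ x y, |(fs x - C x y) / ε| ≤ F) (hg : ∀ x y, |(gs y - C x y) / ε| ≤ F) :
    HasScale (relScaling ε fs (atomicPotential ε C (fun _ => 0) y₀))
      (relScaling ε gs (atomicPotential ε (fun y x => C x y) (fun _ => 0) x₀))
      ((m * Real.exp F) ^ 2) := by
  have : NeZero m := ⟨by positivity⟩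
  have hm' : (1 : ℝ) ≤ m := by exact_mod_cast hm
  have bound (c : X → X → ℝ) (r : X → ℝ) (z : Fin m → X) (hr : ∀ x y, |(r x - c x y) / ε| ≤ F)
      (x : X) : (m * Real.exp F)⁻¹ ≤ relScaling ε r (atomicPotential ε c (fun _ => 0) z) x ∧
        relScaling ε r (atomicPotential ε c (fun _ => 0) z) x ≤ m * Real.exp F := by
    have hsum : relScaling ε r (atomicPotential ε c (fun _ => 0) z) x
        = ∑ i, Real.exp ((r x - c x (z i)) / ε) := by
      simp [relScaling_atomicPotential hε hm fun _ => 0, planDensity]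
    rw [hsum, mul_inv, ← Real.exp_neg]
    constructor
    · calc (m : ℝ)⁻¹ * Real.exp (-F) ≤ m * Real.exp (-F) := by
            gcongr; exact (inv_le_one_of_one_le₀ hm').trans hm'
        _ ≤ _ := by
            simpa using Finset.card_nsmul_le_sum Finset.univ _ _ fun i _ =>
              Real.exp_le_exp.2 (abs_le.1 (hr x (z i))).1
    · simpa using Finset.sum_le_card_nsmul Finset.univ _ _ fun i _ =>
        Real.exp_le_exp.2 (abs_le.1 (hr x (z i))).2
  intro x y
  obtain ⟨hl, hu⟩ := bound C fs y₀ hf x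
  obtain ⟨hl', hu'⟩ := bound (fun y x => C x y) gs x₀ (fun y x => hg x y) y
  rw [sq, mul_inv]
  exact ⟨mul_le_mul hl hl' (by positivity) (relScaling_pos x).le,
    mul_le_mul hu hu' (relScaling_pos y).le (by positivity)⟩

theorem isMarkovDensity_planDensity [MeasurableSpace X] {μ : Measure X} [IsProbabilityMeasure μ]
    {F : ℝ} (hε : ε ≠ 0) (hgs : Measurable gs) (hC : ∀ x, Measurable (C x))
    (hF : ∀ x y, |(fs x + gs y - C x y) / ε| ≤ F) (hfs : ∀ x, fs x = softTransform ε C μ gs x) :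
    IsMarkovDensity μ (planDensity ε C fs gs) (Real.exp (-F)) where
  pos := Real.exp_pos _
  measurable x := Real.measurable_exp.comp (((hgs.const_add _).sub (hC x)).div_const ε)
  le x y := Real.exp_le_exp.2 (abs_le.1 (hF x y)).1
  le_inv x y := by
    rw [← Real.exp_neg, neg_neg]
    exact Real.exp_le_exp.2 (abs_le.1 (hF x y)).2
  integral_eq_one x := by
    have factor : ∀ y, Real.exp ((gs y - C x y) / ε)
        = Real.exp (-(fs x / ε)) * planDensity ε C fs gs x y := fun y => by
      rw [planDensity, ← Real.exp_add]; ring_nf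
    have hint : Integrable (planDensity ε C fs gs x) μ :=
      .of_bound (Real.measurable_exp.comp
        (((hgs.const_add _).sub (hC x)).div_const ε)).aestronglyMeasurable (Real.exp F)
        (Filter.Eventually.of_forall fun y => by
          rw [planDensity, Real.norm_of_nonneg (Real.exp_pos _).le]
          exact Real.exp_le_exp.2 (abs_le.1 (hF x y)).2)
    have hpos : 0 < ∫ y, Real.exp ((gs y - C x y) / ε) ∂μ :=
      integral_exp_pos (by simpa only [factor] using hint.const_mul _)
    have hval : ∫ y, Real.exp ((gs y - C x y) / ε) ∂μ = Real.exp (-(fs x / ε)) := by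
      rw [← Real.exp_log hpos, hfs x, softTransform]
      field_simp
    refine mul_left_cancel₀ (Real.exp_pos (-(fs x / ε))).ne' ?_
    rw [mul_one, ← integral_const_mul]
    simpa only [factor] using hval

end Potentials

section VarNorm

variable {X : Type*} {h : X → ℝ} {r : ℝ}

theorem varNorm_le [Nonempty X] (hr : ∀ x x', h x - h x' ≤ r) : varNorm h ≤ r := by
  rw [varNorm, sub_le_iff_le_add']
  refine ciSup_le fun x => ?_
  rw [← sub_le_iff_le_add]
  exact le_ciInf fun x' => by linarith [hr x x']

theorem sub_le_varNorm (ha : BddAbove (Set.range h)) (hb : BddBelow (Set.range h)) (x x' : X) :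
    h x - h x' ≤ varNorm h :=
  sub_le_sub (le_ciSup ha x) (ciInf_le hb x')

theorem varNorm_nonneg [Nonempty X] (ha : BddAbove (Set.range h)) (hb : BddBelow (Set.range h)) :
    0 ≤ varNorm h :=
  sub_nonneg.2 (ciInf_le_ciSup hb ha)

variable {ε : ℝ} {fs f : X → ℝ} {R : ℝ}

theorem relScaling_eq_exp_mul (x x' : X) : relScaling ε fs f x
    = Real.exp ((f x' - fs x') / ε - (f x - fs x) / ε) * relScaling ε fs f x' := by
  rw [relScaling, relScaling, ← Real.exp_add]
  ring_nf

theorem exp_varNorm_le_of_ratioLE [Nonempty X] (h : RatioLE (relScaling ε fs f) R) :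
    Real.exp (varNorm fun x => (f x - fs x) / ε) ≤ R := by
  have hexp : ∀ x x', Real.exp ((f x - fs x) / ε - (f x' - fs x') / ε) ≤ R := fun x x' =>
    le_of_mul_le_mul_right ((relScaling_eq_exp_mul x' x).symm.trans_le (h x' x)) (relScaling_pos x)
  have hR : 0 < R :=
    (Real.exp_pos _).trans_le (hexp (Classical.arbitrary X) (Classical.arbitrary X))
  rw [← Real.le_log_iff_exp_le hR]
  exact varNorm_le fun x x' => (Real.le_log_iff_exp_le hR).2 (hexp x x')

theorem ratioLE_exp_varNorm (ha : BddAbove (Set.range fun x => (f x - fs x) / ε))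
    (hb : BddBelow (Set.range fun x => (f x - fs x) / ε)) :
    RatioLE (relScaling ε fs f) (Real.exp (varNorm fun x => (f x - fs x) / ε)) := fun x x' => by
  rw [relScaling_eq_exp_mul x x']
  have := (relScaling_pos (ε := ε) (fs := fs) (f := f) x').le
  gcongr
  exact sub_le_varNorm ha hb x' x

end VarNorm

section RegularPlan

variable {X : Type*} [MeasurableSpace X] {ε κ Λ δ : ℝ} {C : X → X → ℝ} {fs gs : X → ℝ}

theorem abs_exp_sub_exp_le {u v B : ℝ} (hu : Real.exp u ≤ B) (hv : Real.exp v ≤ B) :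
    |Real.exp u - Real.exp v| ≤ B * |u - v| := by
  wlog huv : v ≤ u generalizing u v
  · rw [abs_sub_comm, abs_sub_comm u]
    exact this hv hu (le_of_not_ge huv)
  rw [abs_of_nonneg (sub_nonneg.2 (Real.exp_le_exp.2 huv)), abs_of_nonneg (sub_nonneg.2 huv)]
  have hmul : Real.exp v = Real.exp u * Real.exp (v - u) := by
    rw [← Real.exp_add]; ring_nf
  nlinarith [mul_le_mul_of_nonneg_left (Real.add_one_le_exp (v - u)) (Real.exp_pos u).le]

theorem IsMarkovDensity.sub_le_of_cost_sub_le {μ : Measure X} [IsFiniteMeasure μ]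
    (hp : IsMarkovDensity μ (planDensity ε C fs gs) κ) (hε : 0 < ε) {x x' : X}
    (hδ : ∀ y, C x y - C x' y ≤ δ) : fs x - fs x' ≤ δ := by
  have hle : ∀ y, Real.exp ((fs x - fs x' - δ) / ε) * planDensity ε C fs gs x' y
      ≤ planDensity ε C fs gs x y := fun y => by
    rw [planDensity, planDensity, ← Real.exp_add, Real.exp_le_exp, ← add_div]
    gcongr
    linarith [hδ y]
  have hone := integral_mono ((hp.integrable x').const_mul _) (hp.integrable x) hle
  rw [integral_const_mul, hp.integral_eq_one, hp.integral_eq_one, mul_one, Real.exp_le_one_iff,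
    div_le_iff₀ hε] at hone
  linarith

theorem IsMarkovDensity.abs_planDensity_sub_le {μ : Measure X} [IsFiniteMeasure μ]
    (hp : IsMarkovDensity μ (planDensity ε C fs gs) κ) (hε : 0 < ε) {x x' : X}
    (hδ : ∀ y, |C x y - C x' y| ≤ δ) (y : X) :
    |planDensity ε C fs gs x y - planDensity ε C fs gs x' y| ≤ κ⁻¹ * (2 * δ / ε) := by
  have hκ := hp.pos
  have hfs : |fs x - fs x'| ≤ δ := abs_sub_le_iff.2
    ⟨hp.sub_le_of_cost_sub_le hε fun y => (abs_sub_le_iff.1 (hδ y)).1,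
      hp.sub_le_of_cost_sub_le hε fun y => (abs_sub_le_iff.1 (hδ y)).2⟩
  refine (abs_exp_sub_exp_le (hp.le_inv x y) (hp.le_inv x' y)).trans ?_
  have : (fs x + gs y - C x y) / ε - (fs x' + gs y - C x' y) / ε
      = ((fs x - fs x') - (C x y - C x' y)) / ε := by ring
  rw [this, abs_div, abs_of_pos hε]
  gcongr
  exact (abs_sub _ _).trans (by linarith [hδ y])

variable [PseudoMetricSpace X] {α β : Measure X}

/-- The regularity of an optimal plan on which the convergence rests: continuous potentials and
cost, and densities in both directions that lie between `κ` and `κ⁻¹` and are `Λ`-Lipschitz. -/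
structure IsRegularPlan (ε : ℝ) (C : X → X → ℝ) (α β : Measure X) (fs gs : X → ℝ) (κ Λ : ℝ) :
    Prop where
  eps_pos : 0 < ε
  continuous_cost : Continuous (Function.uncurry C)
  continuous_left : Continuous fs
  continuous_right : Continuous gs
  isMarkovDensity_left : IsMarkovDensity β (planDensity ε C fs gs) κ
  isMarkovDensity_right : IsMarkovDensity α (planDensity ε (fun y x => C x y) gs fs) κ
  lipschitz_nonneg : 0 ≤ Λ
  lipschitz_left : ∀ x x' y,
    |planDensity ε C fs gs x y - planDensity ε C fs gs x' y| ≤ Λ * dist x x'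
  lipschitz_right : ∀ y y' x, |planDensity ε (fun y x => C x y) gs fs y x
    - planDensity ε (fun y x => C x y) gs fs y' x| ≤ Λ * dist y y'

theorem IsRegularPlan.symm (h : IsRegularPlan ε C α β fs gs κ Λ) :
    IsRegularPlan ε (fun y x => C x y) β α gs fs κ Λ :=
  ⟨h.eps_pos, h.continuous_cost.comp continuous_swap, h.continuous_right, h.continuous_left,
    h.isMarkovDensity_right, h.isMarkovDensity_left, h.lipschitz_nonneg, h.lipschitz_right,
    h.lipschitz_left⟩

theorem exists_abs_le_of_continuous {Z : Type*} [TopologicalSpace Z] [CompactSpace Z] {f : Z → ℝ}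
    (hf : Continuous f) : ∃ F, ∀ z, |f z| ≤ F :=
  (isCompact_univ.exists_bound_of_continuousOn hf.continuousOn).imp fun _ hF z => hF z trivial

theorem exists_isRegularPlan [CompactSpace X] [BorelSpace X] [IsProbabilityMeasure α]
    [IsProbabilityMeasure β] (hε : 0 < ε) {L : ℝ≥0} (hC : LipschitzWith L (Function.uncurry C))
    (hopt : IsOptimalPotentials ε C α β fs gs) :
    ∃ κ Λ, IsRegularPlan ε C α β fs gs κ Λ := by
  have hfs := hopt.continuous_left
  have hgs := hopt.continuous_right
  obtain ⟨F, hF⟩ := exists_abs_le_of_continuous (Z := X × X)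
    (f := fun z => (fs z.1 + gs z.2 - C z.1 z.2) / ε) (by
      have : Continuous fun z : X × X => C z.1 z.2 := hC.continuous
      fun_prop)
  have hCx : ∀ x x' y, |C x y - C x' y| ≤ L * dist x x' := fun x x' y => by
    simpa [Prod.dist_eq, Real.dist_eq] using hC.dist_le_mul (x, y) (x', y)
  have hCy : ∀ y y' x, |C x y - C x y'| ≤ L * dist y y' := fun y y' x => by
    simpa [Prod.dist_eq, Real.dist_eq] using hC.dist_le_mul (x, y) (x, y')
  have hp : IsMarkovDensity β (planDensity ε C fs gs) (Real.exp (-F)) :=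
    isMarkovDensity_planDensity hε.ne' hgs.measurable
      (fun x => (hC.continuous.comp (.prodMk_right x)).measurable) (fun x y => hF (x, y))
      hopt.left_eq
  have hq : IsMarkovDensity α (planDensity ε (fun y x => C x y) gs fs) (Real.exp (-F)) :=
    isMarkovDensity_planDensity hε.ne' hfs.measurable
      (fun y => (hC.continuous.comp (.prodMk_left y)).measurable)
      (fun y x => by simpa only [add_comm] using hF (x, y)) hopt.right_eq
  refine ⟨Real.exp (-F), (Real.exp (-F))⁻¹ * (2 * L / ε), hε, hC.continuous, hfs, hgs, hp, hq,
    by positivity, fun x x' y => ?_, fun y y' x => ?_⟩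
  · exact (hp.abs_planDensity_sub_le hε (hCx x x') y).trans_eq (by ring)
  · exact (hq.abs_planDensity_sub_le hε (hCy y y') x).trans_eq (by ring)

end RegularPlan

section SamplingNoise

variable {X : Type*} [MeasurableSpace X] {ε κ Λ : ℝ} {C : X → X → ℝ} {μ : Measure X}
  {fs gs h : X → ℝ} {n : ℕ}

/-- The largest sampling error of a half-step in which the batch `ξ` is fed through the potential
`h`. It is normalised at the point `o` so that adding constants to `h` does not change it. -/
def samplingNoise (ε : ℝ) (C : X → X → ℝ) (μ : Measure X) (fs gs h : X → ℝ) (o : X)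
    (ξ : Fin n → X) : ℝ :=
  supDeviation μ
    (fun x y => planDensity ε C fs gs x y * (relScaling ε gs h o / relScaling ε gs h y)) ξ

theorem measurable_planDensity_mul {Θ : Type*} [MeasurableSpace Θ] {H : Θ → X → ℝ}
    (hp : IsMarkovDensity μ (planDensity ε C fs gs) κ)
    (hgs : Measurable gs) (hH : Measurable (Function.uncurry H)) (o x : X) :
    Measurable fun q : Θ × X => planDensity ε C fs gs x q.2
      * (relScaling ε gs (H q.1) o / relScaling ε gs (H q.1) q.2) := by
  have hscaling : Measurable fun q : Θ × X => relScaling ε gs (H q.1) q.2 :=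
    Real.measurable_exp.comp (((hgs.comp measurable_snd).sub hH).div_const ε)
  exact ((hp.measurable x).comp measurable_snd).mul
    ((hscaling.comp (measurable_fst.prodMk measurable_const)).div hscaling)

variable [PseudoMetricSpace X]

theorem isBoundedLipschitzFamily_planDensity_mul (hp : IsMarkovDensity μ (planDensity ε C fs gs) κ)
    (hΛ₀ : 0 ≤ Λ)
    (hΛ : ∀ x x' y, |planDensity ε C fs gs x y - planDensity ε C fs gs x' y| ≤ Λ * dist x x')
    (hgs : Measurable gs) (hh : Measurable h) (hr : RatioLE (relScaling ε gs h) (κ⁻¹ ^ 2)) (o : X) :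
    IsBoundedLipschitzFamily (κ⁻¹ ^ 3 + Λ * κ⁻¹ ^ 2)
      fun x y => planDensity ε C fs gs x y * (relScaling ε gs h o / relScaling ε gs h y) := by
  have hκ := hp.pos
  have hratio : ∀ y, |relScaling ε gs h o / relScaling ε gs h y| ≤ κ⁻¹ ^ 2 := fun y => by
    rw [abs_of_pos (div_pos (relScaling_pos _) (relScaling_pos _)), div_le_iff₀ (relScaling_pos _)]
    exact hr o y
  refine ⟨fun x => (hp.measurable x).mul (measurable_const.div ?_), fun x y => ?_,
    fun x x' y => ?_⟩
  · exact Real.measurable_exp.comp ((hgs.sub hh).div_const ε)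
  · have hpos : 0 < planDensity ε C fs gs x y := Real.exp_pos _
    rw [abs_mul, abs_of_pos hpos]
    calc _ ≤ κ⁻¹ * κ⁻¹ ^ 2 :=
          mul_le_mul (hp.le_inv x y) (hratio y) (abs_nonneg _) (inv_nonneg.2 hκ.le)
      _ = κ⁻¹ ^ 3 := (pow_succ' _ _).symm
      _ ≤ _ := le_add_of_nonneg_right (by positivity)
  · rw [← sub_mul, abs_mul]
    calc _ ≤ (Λ * dist x x') * κ⁻¹ ^ 2 :=
          mul_le_mul (hΛ x x' y) (hratio y) (abs_nonneg _) (by positivity)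
      _ ≤ (κ⁻¹ ^ 3 + Λ * κ⁻¹ ^ 2) * dist x x' := by
          nlinarith [mul_nonneg (pow_nonneg (inv_nonneg.2 hκ.le) 3)
            (dist_nonneg (x := x) (y := x'))]

theorem abs_empiricalDeviation_le_samplingNoise [IsProbabilityMeasure μ]
    (hp : IsMarkovDensity μ (planDensity ε C fs gs) κ) (hΛ₀ : 0 ≤ Λ)
    (hΛ : ∀ x x' y, |planDensity ε C fs gs x y - planDensity ε C fs gs x' y| ≤ Λ * dist x x')
    (hgs : Measurable gs) (hh : Measurable h) (hr : RatioLE (relScaling ε gs h) (κ⁻¹ ^ 2))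
    (hn : 1 ≤ n) (o : X) (ξ : Fin n → X) (x : X) :
    |empiricalDeviation μ
        (fun y => planDensity ε C fs gs x y * (relScaling ε gs h o / relScaling ε gs h y)) ξ|
      ≤ samplingNoise ε C μ fs gs h o ξ :=
  abs_empiricalDeviation_le_supDeviation
    (isBoundedLipschitzFamily_planDensity_mul hp hΛ₀ hΛ hgs hh hr o) hn ξ x

/-- The constant in front of `1 / √n` in the bound for the mean sampling noise. -/
def noiseConst (κ Λ D : ℝ) : ℝ := (κ⁻¹ ^ 3 + Λ * κ⁻¹ ^ 2) * (20 * D ^ 2 + 9 * D + 3)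

variable [IsProbabilityMeasure μ] [TopologicalSpace.SeparableSpace X] {Θ Ω : Type*}
  [MeasurableSpace Θ] [MeasurableSpace Ω] {P : Measure Ω} [IsProbabilityMeasure P]
  {H : Θ → X → ℝ} {θ : Ω → Θ} {ξ : Ω → Fin n → X}

theorem integrable_samplingNoise (hp : IsMarkovDensity μ (planDensity ε C fs gs) κ)
    (hΛ₀ : 0 ≤ Λ)
    (hΛ : ∀ x x' y, |planDensity ε C fs gs x y - planDensity ε C fs gs x' y| ≤ Λ * dist x x')
    (hgs : Measurable gs) (hH : Measurable (Function.uncurry H))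
    (hr : ∀ θ, RatioLE (relScaling ε gs (H θ)) (κ⁻¹ ^ 2)) (o : X) (hn : 1 ≤ n)
    (hθ : Measurable θ) (hξ : Measurable ξ) :
    Integrable (fun ω => samplingNoise ε C μ fs gs (H (θ ω)) o (ξ ω)) P :=
  have : Nonempty X := ⟨o⟩
  integrable_supDeviation (ψ := fun θ x y => planDensity ε C fs gs x y
      * (relScaling ε gs (H θ) o / relScaling ε gs (H θ) y))
    (measurable_planDensity_mul hp hgs hH o)
    (fun θ => isBoundedLipschitzFamily_planDensity_mul hp hΛ₀ hΛ hgs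
      (hH.comp measurable_prodMk_left) (hr θ) o) hn hθ hξ

theorem integral_samplingNoise_le {D : ℝ} (hX : HasDyadicNets X D) (hD : 0 < D)
    (hp : IsMarkovDensity μ (planDensity ε C fs gs) κ) (hΛ₀ : 0 ≤ Λ)
    (hΛ : ∀ x x' y, |planDensity ε C fs gs x y - planDensity ε C fs gs x' y| ≤ Λ * dist x x')
    (hgs : Measurable gs) (hH : Measurable (Function.uncurry H))
    (hr : ∀ θ, RatioLE (relScaling ε gs (H θ)) (κ⁻¹ ^ 2)) (o : X) (hn : 1 ≤ n)
    (hθ : Measurable θ) (hξ : Measurable ξ) (hind : IndepFun θ ξ P)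
    (hlaw : P.map ξ = Measure.pi fun _ => μ) :
    ∫ ω, samplingNoise ε C μ fs gs (H (θ ω)) o (ξ ω) ∂P ≤ noiseConst κ Λ D / √n :=
  have : Nonempty X := ⟨o⟩
  have hκ := hp.pos
  integral_supDeviation_le_of_indepFun (ψ := fun θ x y => planDensity ε C fs gs x y
      * (relScaling ε gs (H θ) o / relScaling ε gs (H θ) y)) hX hD
    (by positivity) (measurable_planDensity_mul hp hgs hH o)
    (fun θ => isBoundedLipschitzFamily_planDensity_mul hp hΛ₀ hΛ hgs
      (hH.comp measurable_prodMk_left) (hr θ) o) hn hθ hξ hind hlaw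

end SamplingNoise

section Measurability

variable {X : Type*} {ε η : ℝ} {C : X → X → ℝ} {m n : ℕ}

theorem measurable_atomicPotential [MeasurableSpace X] {Θ : Type*} [MeasurableSpace Θ]
    {w : Θ → Fin m → ℝ} {z : Θ → Fin m → X} {x : Θ → X} (hC : Measurable (Function.uncurry C))
    (hw : Measurable w) (hz : Measurable z) (hx : Measurable x) :
    Measurable fun θ => atomicPotential ε C (w θ) (z θ) (x θ) := by
  refine (Real.measurable_log.comp (Finset.measurable_fun_sum _ fun i _ => ?_)).const_mul (-ε)
  exact Real.measurable_exp.comp ((((measurable_pi_apply i).comp hw).sub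
    (hC.comp (hx.prodMk ((measurable_pi_apply i).comp hz)))).div_const ε)

theorem measurable_onlineUpdate [MeasurableSpace X] {Θ : Type*} [MeasurableSpace Θ]
    {w : Θ → Fin m → ℝ} {z : Θ → Fin m → X} {h : Θ → X → ℝ} {ξ : Θ → Fin n → X} {x : Θ → X}
    (hC : Measurable (Function.uncurry C)) (hw : Measurable w) (hz : Measurable z)
    (hh : ∀ j, Measurable fun θ => h θ (ξ θ j)) (hξ : Measurable ξ) (hx : Measurable x) :
    Measurable fun θ => onlineUpdate ε C η (w θ) (z θ) (h θ) (ξ θ) (x θ) := by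
  refine (Real.measurable_log.comp (.add (Finset.measurable_fun_sum _ fun i _ => ?_)
    (Finset.measurable_fun_sum _ fun j _ => ?_))).const_mul (-ε)
  · exact (Real.measurable_exp.comp ((((measurable_pi_apply i).comp hw).sub
      (hC.comp (hx.prodMk ((measurable_pi_apply i).comp hz)))).div_const ε)).const_mul (1 - η)
  · have hξj : Measurable fun θ => ξ θ j := (measurable_pi_apply j).comp hξ
    exact (Real.measurable_exp.comp (((hh j).sub
      (hC.comp (hx.prodMk hξj))).div_const ε)).const_mul (η / n)

theorem continuous_atomicPotential [TopologicalSpace X] (hC : Continuous (Function.uncurry C))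
    (hm : 1 ≤ m) (w : Fin m → ℝ) (z : Fin m → X) : Continuous (atomicPotential ε C w z) := by
  have : NeZero m := ⟨by positivity⟩
  have hsum : Continuous fun x => ∑ i, Real.exp ((w i - C x (z i)) / ε) :=
    continuous_finsetSum _ fun i _ => Real.continuous_exp.comp
      ((continuous_const.sub (hC.comp (.prodMk_left (z i)))).div_const ε)
  exact continuous_const.mul (hsum.log fun x =>
    (Finset.sum_pos (fun i _ => Real.exp_pos _) Finset.univ_nonempty).ne')

end Measurability

section RatioExcess

variable {X : Type*} {ε : ℝ} {fs gs f g : X → ℝ} {R : ℝ}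

/-- The smallest `M` such that the scalings relative to the optimal ones have ratios at most
`1 + M`. It dominates the error of the potentials, and in contrast to the error it satisfies a
linear recursion. -/
def ratioExcess (ε : ℝ) (fs gs f g : X → ℝ) : ℝ :=
  max (Real.exp (varNorm fun x => (f x - fs x) / ε))
    (Real.exp (varNorm fun y => (g y - gs y) / ε)) - 1

theorem varNorm_add_varNorm_le_ratioExcess :
    varNorm (fun x => (f x - fs x) / ε) + varNorm (fun y => (g y - gs y) / ε)
      ≤ 2 * ratioExcess ε fs gs f g := by
  have hf := Real.add_one_le_exp (varNorm fun x => (f x - fs x) / ε)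
  have hg := Real.add_one_le_exp (varNorm fun y => (g y - gs y) / ε)
  rw [ratioExcess]
  linarith [le_max_left (Real.exp (varNorm fun x => (f x - fs x) / ε))
      (Real.exp (varNorm fun y => (g y - gs y) / ε)),
    le_max_right (Real.exp (varNorm fun x => (f x - fs x) / ε))
      (Real.exp (varNorm fun y => (g y - gs y) / ε))]

theorem ratioExcess_le [Nonempty X] (hf : RatioLE (relScaling ε fs f) R)
    (hg : RatioLE (relScaling ε gs g) R) : ratioExcess ε fs gs f g ≤ R - 1 :=
  sub_le_sub_right (max_le (exp_varNorm_le_of_ratioLE hf) (exp_varNorm_le_of_ratioLE hg)) 1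

variable [TopologicalSpace X] [CompactSpace X]

theorem varNorm_sub_div_nonneg [Nonempty X] (hfs : Continuous fs) (hf : Continuous f) :
    0 ≤ varNorm fun x => (f x - fs x) / ε :=
  have hc : IsCompact (Set.range fun x => (f x - fs x) / ε) :=
    isCompact_range ((hf.sub hfs).div_const ε)
  varNorm_nonneg hc.bddAbove hc.bddBelow

theorem ratioExcess_nonneg [Nonempty X] (hfs : Continuous fs) (hf : Continuous f) :
    0 ≤ ratioExcess ε fs gs f g :=
  sub_nonneg.2 (le_max_of_le_left (Real.one_le_exp (varNorm_sub_div_nonneg hfs hf)))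

theorem ratioLE_exp_varNorm_sub_div (hfs : Continuous fs) (hf : Continuous f) :
    RatioLE (relScaling ε fs f) (Real.exp (varNorm fun x => (f x - fs x) / ε)) :=
  have hc : IsCompact (Set.range fun x => (f x - fs x) / ε) :=
    isCompact_range ((hf.sub hfs).div_const ε)
  ratioLE_exp_varNorm hc.bddAbove hc.bddBelow

theorem ratioLE_left_ratioExcess (hfs : Continuous fs) (hf : Continuous f) :
    RatioLE (relScaling ε fs f) (1 + ratioExcess ε fs gs f g) :=
  (ratioLE_exp_varNorm_sub_div hfs hf).mono (fun x => (relScaling_pos x).le) (by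
    rw [ratioExcess, add_sub_cancel]; exact le_max_left _ _)

theorem ratioLE_right_ratioExcess (hgs : Continuous gs) (hg : Continuous g) :
    RatioLE (relScaling ε gs g) (1 + ratioExcess ε fs gs f g) :=
  (ratioLE_exp_varNorm_sub_div hgs hg).mono (fun x => (relScaling_pos x).le) (by
    rw [ratioExcess, add_sub_cancel]; exact le_max_right _ _)

end RatioExcess

theorem ratioLE_relScaling_onlineUpdate {X : Type*} [MeasurableSpace X] {μ : Measure X} {ε η κ : ℝ}
    {C : X → X → ℝ} {fs gs h : X → ℝ} {m n : ℕ} {w : Fin m → ℝ} {z : Fin m → X} {ξ : Fin n → X}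
    (hp : IsMarkovDensity μ (planDensity ε C fs gs) κ) (hε : ε ≠ 0) (hη₀ : 0 ≤ η) (hη₁ : η ≤ 1)
    (hm : 1 ≤ m) (hn : 1 ≤ n) :
    RatioLE (relScaling ε fs (onlineUpdate ε C η w z h ξ)) (κ⁻¹ ^ 2) := by
  rw [relScaling_onlineUpdate (gs := gs) hε hη₀ hη₁ hm hn]
  exact ratioLE_sinkhornUpdate hp (ratioLE_relScaling_atomicPotential hp hε hm)
    (fun y => relScaling_pos y) hη₀ hη₁

/-- Admissible parameters of a run: learning rates in `[0, 1]`, and at least one sample and one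
point in every iteration. -/
structure IsSchedule (η : ℕ → ℝ) (bs m : ℕ → ℕ) : Prop where
  nonneg : ∀ {t}, 1 ≤ t → 0 ≤ η t
  le_one : ∀ {t}, 1 ≤ t → η t ≤ 1
  one_le_batch : ∀ {t}, 1 ≤ t → 1 ≤ bs t
  one_le_size : ∀ {t}, 1 ≤ t → 1 ≤ m t

namespace Run

variable {X : Type*} [MeasurableSpace X] {α β : Measure X} {η : ℕ → ℝ}
  {bs m : ℕ → ℕ} {Ω : Type*} [MeasurableSpace Ω] {P : Measure Ω}
  {ε κ Λ D B : ℝ} {C : X → X → ℝ} {fs gs : X → ℝ} {t : ℕ}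

section Noise

/-- The potential `ĝ_t` as a function of the points and weights in use at iteration `t`. -/
def ghatOfState (ε : ℝ) (C : X → X → ℝ) {m : ℕ}
    (σ : State X m) : X → ℝ :=
  atomicPotential ε (fun y x => C x y) σ.2.1 σ.1

/-- The potential `f_{t+1}` as a function of the points and weights in use at iteration `t` and of
the batch from `β`. -/
def fnextOfState (ε : ℝ) (C : X → X → ℝ) (η : ℝ) {m n : ℕ}
    (σ : State X m × (Fin n → X)) : X → ℝ :=
  onlineUpdate ε C η σ.1.2.2.2 σ.1.2.2.1 (ghatOfState ε C σ.1) σ.2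

theorem measurable_ghatOfState (hC : Measurable (Function.uncurry C)) {m : ℕ} :
    Measurable (Function.uncurry (ghatOfState (m := m) ε C)) :=
  measurable_atomicPotential (Θ := State X m × X) (C := fun y x => C x y) (w := fun q => q.1.2.1)
    (z := fun q => q.1.1) (x := Prod.snd) (hC.comp measurable_swap) (by fun_prop) (by fun_prop)
    measurable_snd

theorem measurable_fnextOfState (hC : Measurable (Function.uncurry C)) {η : ℝ} {m n : ℕ} :
    Measurable (Function.uncurry (fnextOfState (m := m) (n := n) ε C η)) :=
  have hghat (j : Fin n) : Measurable fun q : (State X m × (Fin n → X)) × X =>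
      ghatOfState ε C q.1.1 (q.1.2 j) :=
    (measurable_ghatOfState hC).comp (g := Function.uncurry (ghatOfState ε C))
      (f := fun q : (State X m × (Fin n → X)) × X => (q.1.1, q.1.2 j)) (by fun_prop)
  measurable_onlineUpdate (Θ := (State X m × (Fin n → X)) × X) (w := fun q => q.1.1.2.2.2)
    (z := fun q => q.1.1.2.2.1) (h := fun q => ghatOfState ε C q.1.1) (ξ := fun q => q.1.2)
    (x := Prod.snd) hC (by fun_prop) (by fun_prop) hghat (by fun_prop) measurable_snd

/-- The sampling noise of the half-step from `f̂_t` to `f_{t+1}`. -/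
def fnoise (R : Run α β η bs m P) (ε : ℝ) (C : X → X → ℝ) (fs gs : X → ℝ) (o : X) (t : ℕ)
    (ω : Ω) : ℝ :=
  samplingNoise ε C β fs gs (R.ghat ε C t ω) o (R.ybatch t ω)

/-- The sampling noise of the half-step from `ĝ_t` to `g_{t+1}`. -/
def gnoise (R : Run α β η bs m P) (ε : ℝ) (C : X → X → ℝ) (fs gs : X → ℝ) (o : X) (t : ℕ)
    (ω : Ω) : ℝ :=
  samplingNoise ε (fun y x => C x y) α gs fs (R.fnext ε C t ω) o (R.xbatch t ω)

variable [PseudoMetricSpace X] [CompactSpace X] [BorelSpace X]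

theorem integrable_fnoise [IsProbabilityMeasure β] (R : Run α β η bs m P) (hs : IsSchedule η bs m)
    (h : IsRegularPlan ε C α β fs gs κ Λ) (ht : 1 ≤ t) (o : X) :
    Integrable (R.fnoise ε C fs gs o t) P :=
  have : IsProbabilityMeasure P := R.indep_samples.isProbabilityMeasure
  integrable_samplingNoise (H := ghatOfState ε C) (θ := R.state t) (ξ := R.ybatch t)
    h.isMarkovDensity_left h.lipschitz_nonneg h.lipschitz_left h.continuous_right.measurable
    (measurable_ghatOfState h.continuous_cost.measurable)
    (fun _ => ratioLE_relScaling_atomicPotential h.isMarkovDensity_right h.eps_pos.ne'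
      (hs.one_le_size ht))
    o (hs.one_le_batch ht) (R.measurable_state ht) (R.measurable_ybatch t)

theorem integral_fnoise_le [IsProbabilityMeasure β] (R : Run α β η bs m P) (hs : IsSchedule η bs m)
    (hX : HasDyadicNets X D) (hD : 0 < D) (h : IsRegularPlan ε C α β fs gs κ Λ) (ht : 1 ≤ t)
    (o : X) : ∫ ω, R.fnoise ε C fs gs o t ω ∂P ≤ noiseConst κ Λ D / √(bs t) :=
  have : IsProbabilityMeasure P := R.indep_samples.isProbabilityMeasure
  integral_samplingNoise_le (H := ghatOfState ε C) (θ := R.state t) (ξ := R.ybatch t)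
    hX hD h.isMarkovDensity_left h.lipschitz_nonneg h.lipschitz_left h.continuous_right.measurable
    (measurable_ghatOfState h.continuous_cost.measurable)
    (fun _ => ratioLE_relScaling_atomicPotential h.isMarkovDensity_right h.eps_pos.ne'
      (hs.one_le_size ht))
    o (hs.one_le_batch ht) (R.measurable_state ht) (R.measurable_ybatch t)
    (R.indepFun_state_ybatch ht) (R.map_ybatch t)

theorem integrable_gnoise [IsProbabilityMeasure α] (R : Run α β η bs m P) (hs : IsSchedule η bs m)
    (h : IsRegularPlan ε C α β fs gs κ Λ) (ht : 1 ≤ t) (o : X) :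
    Integrable (R.gnoise ε C fs gs o t) P :=
  have : IsProbabilityMeasure P := R.indep_samples.isProbabilityMeasure
  integrable_samplingNoise (H := fnextOfState ε C (η t))
    (θ := fun ω => (R.state t ω, R.ybatch t ω)) (ξ := R.xbatch t)
    h.isMarkovDensity_right h.lipschitz_nonneg h.lipschitz_right h.continuous_left.measurable
    (measurable_fnextOfState h.continuous_cost.measurable)
    (fun _ => ratioLE_relScaling_onlineUpdate h.isMarkovDensity_left h.eps_pos.ne'
      (hs.nonneg ht) (hs.le_one ht) (hs.one_le_size ht) (hs.one_le_batch ht))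
    o (hs.one_le_batch ht) ((R.measurable_state ht).prodMk (R.measurable_ybatch t))
    (R.measurable_xbatch t)

theorem integral_gnoise_le [IsProbabilityMeasure α] (R : Run α β η bs m P) (hs : IsSchedule η bs m)
    (hX : HasDyadicNets X D) (hD : 0 < D) (h : IsRegularPlan ε C α β fs gs κ Λ) (ht : 1 ≤ t)
    (o : X) : ∫ ω, R.gnoise ε C fs gs o t ω ∂P ≤ noiseConst κ Λ D / √(bs t) :=
  have : IsProbabilityMeasure P := R.indep_samples.isProbabilityMeasure
  integral_samplingNoise_le (H := fnextOfState ε C (η t))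
    (θ := fun ω => (R.state t ω, R.ybatch t ω)) (ξ := R.xbatch t)
    hX hD h.isMarkovDensity_right h.lipschitz_nonneg h.lipschitz_right h.continuous_left.measurable
    (measurable_fnextOfState h.continuous_cost.measurable)
    (fun _ => ratioLE_relScaling_onlineUpdate h.isMarkovDensity_left h.eps_pos.ne'
      (hs.nonneg ht) (hs.le_one ht) (hs.one_le_size ht) (hs.one_le_batch ht))
    o (hs.one_le_batch ht) ((R.measurable_state ht).prodMk (R.measurable_ybatch t))
    (R.measurable_xbatch t) (R.indepFun_state_ybatch_xbatch ht) (R.map_xbatch t)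

end Noise

end Run

namespace Run

variable {X : Type*} [MeasurableSpace X] {α β : Measure X} {η : ℕ → ℝ} {bs m : ℕ → ℕ} {Ω : Type*}
  [MeasurableSpace Ω] {P : Measure Ω} {ε κ Λ D B F : ℝ} {C : X → X → ℝ} {fs gs : X → ℝ}
  {δ : ℕ → ℝ} {t : ℕ} {ω : Ω}

section Scale

/-- A bound for the scale that depends only on the data, for runs whose compression errors sum up
to at most `S`. -/
def scaleBound (κ F S : ℝ) (m₁ : ℕ) : ℝ :=
  Real.exp (2 * S) * max (κ⁻¹ ^ 3) ((m₁ * Real.exp F) ^ 2)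

theorem le_scaleBound {S : ℝ} {m₁ : ℕ} (hκ : 0 < κ) (hS : 0 ≤ S) :
    κ⁻¹ ^ 3 ≤ scaleBound κ F S m₁ :=
  (le_max_left _ _).trans (le_mul_of_one_le_left (by positivity) (Real.one_le_exp (by linarith)))

theorem relScaling_fnext (R : Run α β η bs m P) (hs : IsSchedule η bs m) (hε : ε ≠ 0)
    (ht : 1 ≤ t) :
    relScaling ε fs (R.fnext ε C t ω)
      = sinkhornUpdate (η t) (planDensity ε C fs gs) (relScaling ε fs (R.fhat ε C t ω))
          (relScaling ε gs (R.ghat ε C t ω)) (R.ybatch t ω) :=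
  relScaling_onlineUpdate hε (hs.nonneg ht) (hs.le_one ht) (hs.one_le_size ht) (hs.one_le_batch ht)

theorem relScaling_gnext (R : Run α β η bs m P) (hs : IsSchedule η bs m) (hε : ε ≠ 0)
    (ht : 1 ≤ t) :
    relScaling ε gs (R.gnext ε C t ω)
      = sinkhornUpdate (η t) (planDensity ε (fun y x => C x y) gs fs)
          (relScaling ε gs (R.ghat ε C t ω)) (relScaling ε fs (R.fnext ε C t ω)) (R.xbatch t ω) :=
  relScaling_onlineUpdate hε (hs.nonneg ht) (hs.le_one ht) (hs.one_le_size ht) (hs.one_le_batch ht)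

/-- The compression error of iteration `t` is at most `ε * δ t`; then compression changes the
scalings by a factor of at most `exp (δ t)`. -/
def CompressionLE (R : Run α β η bs m P) (ε : ℝ) (C : X → X → ℝ) (δ : ℕ → ℝ) (ω : Ω) : Prop :=
  ∀ t, 1 ≤ t → (∀ x, |R.fnext ε C t ω x - R.fhat ε C (t + 1) ω x| ≤ ε * δ t) ∧
    ∀ y, |R.gnext ε C t ω y - R.ghat ε C (t + 1) ω y| ≤ ε * δ t

variable [PseudoMetricSpace X]

theorem isScalingPair_next (R : Run α β η bs m P) (hs : IsSchedule η bs m)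
    (h : IsRegularPlan ε C α β fs gs κ Λ) (hB : κ⁻¹ ^ 3 ≤ B) (ht : 1 ≤ t)
    (hpair : IsScalingPair κ B (relScaling ε fs (R.fhat ε C t ω))
      (relScaling ε gs (R.ghat ε C t ω))) :
    IsScalingPair κ B (relScaling ε fs (R.fnext ε C t ω)) (relScaling ε gs (R.gnext ε C t ω)) := by
  have hf := hpair.sinkhornUpdate (ξ := R.ybatch t ω) h.isMarkovDensity_left hB (hs.nonneg ht)
    (hs.le_one ht) (hs.one_le_batch ht)
  rw [← R.relScaling_fnext hs h.eps_pos.ne' ht] at hf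
  rw [R.relScaling_gnext hs h.eps_pos.ne' ht]
  exact (hf.symm.sinkhornUpdate h.isMarkovDensity_right hB (hs.nonneg ht) (hs.le_one ht)
    (hs.one_le_batch ht)).symm

theorem isScalingPair_hat_succ (R : Run α β η bs m P) (hs : IsSchedule η bs m)
    (h : IsRegularPlan ε C α β fs gs κ Λ) (hcomp : R.CompressionLE ε C δ ω) (ht : 1 ≤ t)
    (hpair : IsScalingPair κ B (relScaling ε fs (R.fnext ε C t ω))
      (relScaling ε gs (R.gnext ε C t ω))) :
    IsScalingPair κ (Real.exp (2 * δ t) * B) (relScaling ε fs (R.fhat ε C (t + 1) ω))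
      (relScaling ε gs (R.ghat ε C (t + 1) ω)) where
  pos_left := relScaling_pos
  pos_right := relScaling_pos
  ratioLE_left := ratioLE_relScaling_atomicPotential h.isMarkovDensity_left h.eps_pos.ne'
    (hs.one_le_size t.succ_pos)
  ratioLE_right := ratioLE_relScaling_atomicPotential h.isMarkovDensity_right h.eps_pos.ne'
    (hs.one_le_size t.succ_pos)
  hasScale := hpair.hasScale.of_perturbation relScaling_pos relScaling_pos
    (fun x => relScaling_le_of_abs_sub_le h.eps_pos ((hcomp t ht).1 x))
    fun y => relScaling_le_of_abs_sub_le h.eps_pos ((hcomp t ht).2 y)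

theorem isScalingPair_hat_one (R : Run α β η bs m P) (hs : IsSchedule η bs m)
    (h : IsRegularPlan ε C α β fs gs κ Λ) (hF : ∀ x y, |(fs x - C x y) / ε| ≤ F)
    (hG : ∀ x y, |(gs y - C x y) / ε| ≤ F) :
    IsScalingPair κ (max (κ⁻¹ ^ 3) ((m 1 * Real.exp F) ^ 2)) (relScaling ε fs (R.fhat ε C 1 ω))
      (relScaling ε gs (R.ghat ε C 1 ω)) where
  pos_left := relScaling_pos
  pos_right := relScaling_pos
  ratioLE_left := ratioLE_relScaling_atomicPotential h.isMarkovDensity_left h.eps_pos.ne'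
    (hs.one_le_size le_rfl)
  ratioLE_right := ratioLE_relScaling_atomicPotential h.isMarkovDensity_right h.eps_pos.ne'
    (hs.one_le_size le_rfl)
  hasScale := by
    have : 0 < m 1 := hs.one_le_size le_rfl
    have hfhat : R.fhat ε C 1 ω = atomicPotential ε C (fun _ => 0) (R.yhat 1 ω) :=
      congrArg (atomicPotential ε C · _) (funext (R.init_qhat ω))
    have hghat :
        R.ghat ε C 1 ω = atomicPotential ε (fun y x => C x y) (fun _ => 0) (R.xhat 1 ω) :=
      congrArg (atomicPotential ε _ · _) (funext (R.init_phat ω))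
    rw [hfhat, hghat]
    have hscale := hasScale_relScaling_atomicPotential_zero (y₀ := R.yhat 1 ω) (x₀ := R.xhat 1 ω)
      h.eps_pos.ne' (hs.one_le_size le_rfl) hF hG
    exact hscale.mono (by positivity) (le_max_right _ _)

theorem isScalingPair_hat (R : Run α β η bs m P) (hs : IsSchedule η bs m)
    (h : IsRegularPlan ε C α β fs gs κ Λ) (hδ : ∀ t, 0 ≤ δ t) (hcomp : R.CompressionLE ε C δ ω)
    (hB : κ⁻¹ ^ 3 ≤ B) (hpair : IsScalingPair κ B (relScaling ε fs (R.fhat ε C 1 ω))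
      (relScaling ε gs (R.ghat ε C 1 ω))) (ht : 1 ≤ t) :
    IsScalingPair κ (Real.exp (2 * ∑ i ∈ Finset.Ico 1 t, δ i) * B)
      (relScaling ε fs (R.fhat ε C t ω)) (relScaling ε gs (R.ghat ε C t ω)) := by
  have hB₀ : 0 ≤ B := le_trans (pow_nonneg (inv_nonneg.2 h.isMarkovDensity_left.pos.le) 3) hB
  induction t, ht using Nat.le_induction with
  | base => simpa using hpair
  | succ t ht ih =>
    have hexp : 1 ≤ Real.exp (2 * ∑ i ∈ Finset.Ico 1 t, δ i) :=
      Real.one_le_exp (mul_nonneg zero_le_two (Finset.sum_nonneg fun i _ => hδ i))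
    have := R.isScalingPair_hat_succ hs h hcomp ht
      (R.isScalingPair_next hs h (hB.trans (le_mul_of_one_le_left hB₀ hexp)) ht ih)
    rwa [← mul_assoc, ← Real.exp_add, ← mul_add, add_comm, ← Finset.sum_Ico_succ_top ht] at this

theorem isScalingPair_scaleBound (R : Run α β η bs m P) (hs : IsSchedule η bs m)
    (h : IsRegularPlan ε C α β fs gs κ Λ) (hF : ∀ x y, |(fs x - C x y) / ε| ≤ F)
    (hG : ∀ x y, |(gs y - C x y) / ε| ≤ F) {S : ℝ} (hδ : ∀ t, 0 ≤ δ t)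
    (hS : ∀ t, ∑ i ∈ Finset.Ico 1 t, δ i ≤ S) (hcomp : R.CompressionLE ε C δ ω) (ht : 1 ≤ t) :
    IsScalingPair κ (scaleBound κ F S (m 1)) (relScaling ε fs (R.fhat ε C t ω))
      (relScaling ε gs (R.ghat ε C t ω)) := by
  have hκ := h.isMarkovDensity_left.pos
  have hpair := R.isScalingPair_hat hs h hδ hcomp (le_max_left _ _)
    (R.isScalingPair_hat_one hs h hF hG) ht
  refine { hpair with hasScale := hpair.hasScale.mono (by positivity) ?_ }
  rw [scaleBound]
  gcongr
  exact hS t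

end Scale

section Excess

/-- The excess of the ratios at the compressed potentials of iteration `t`. -/
def excess (R : Run α β η bs m P) (ε : ℝ) (C : X → X → ℝ) (fs gs : X → ℝ) (t : ℕ) (ω : Ω) : ℝ :=
  ratioExcess ε fs gs (R.fhat ε C t ω) (R.ghat ε C t ω)

theorem errorAt_le_excess (R : Run α β η bs m P) (N : ℕ) (ω : Ω) :
    R.errorAt ε C fs gs N ω ≤ 2 * R.excess ε C fs gs (firstIter bs N) ω :=
  varNorm_add_varNorm_le_ratioExcess

variable [PseudoMetricSpace X]

theorem continuous_fhat (R : Run α β η bs m P) (hs : IsSchedule η bs m)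
    (h : IsRegularPlan ε C α β fs gs κ Λ) (ht : 1 ≤ t) : Continuous (R.fhat ε C t ω) :=
  continuous_atomicPotential h.continuous_cost (hs.one_le_size ht) _ _

theorem continuous_ghat (R : Run α β η bs m P) (hs : IsSchedule η bs m)
    (h : IsRegularPlan ε C α β fs gs κ Λ) (ht : 1 ≤ t) : Continuous (R.ghat ε C t ω) :=
  continuous_atomicPotential h.symm.continuous_cost (hs.one_le_size ht) _ _

theorem excess_le [Nonempty X] (R : Run α β η bs m P) (hs : IsSchedule η bs m)
    (h : IsRegularPlan ε C α β fs gs κ Λ) (ht : 1 ≤ t) :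
    R.excess ε C fs gs t ω ≤ κ⁻¹ ^ 2 - 1 :=
  ratioExcess_le
    (ratioLE_relScaling_atomicPotential h.isMarkovDensity_left h.eps_pos.ne' (hs.one_le_size ht))
    (ratioLE_relScaling_atomicPotential h.isMarkovDensity_right h.eps_pos.ne' (hs.one_le_size ht))

variable [CompactSpace X]

theorem excess_nonneg [Nonempty X] (R : Run α β η bs m P) (hs : IsSchedule η bs m)
    (h : IsRegularPlan ε C α β fs gs κ Λ) (ht : 1 ≤ t) : 0 ≤ R.excess ε C fs gs t ω :=
  ratioExcess_nonneg h.continuous_left (R.continuous_fhat hs h ht)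

variable [BorelSpace X]

theorem measurable_fhat (R : Run α β η bs m P) (h : IsRegularPlan ε C α β fs gs κ Λ)
    (ht : 1 ≤ t) (x : X) : Measurable fun ω => R.fhat ε C t ω x :=
  measurable_atomicPotential h.continuous_cost.measurable (R.measurable_qhat t ht)
    (R.measurable_yhat t ht) measurable_const

theorem measurable_ghat (R : Run α β η bs m P) (h : IsRegularPlan ε C α β fs gs κ Λ)
    (ht : 1 ≤ t) (y : X) : Measurable fun ω => R.ghat ε C t ω y :=
  measurable_atomicPotential h.symm.continuous_cost.measurable (R.measurable_phat t ht)
    (R.measurable_xhat t ht) measurable_const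

theorem measurable_varNorm_fhat (R : Run α β η bs m P) (hs : IsSchedule η bs m)
    (h : IsRegularPlan ε C α β fs gs κ Λ) (ht : 1 ≤ t) :
    Measurable fun ω => varNorm fun x => (R.fhat ε C t ω x - fs x) / ε :=
  measurable_varNorm (fun x => ((R.measurable_fhat h ht x).sub_const _).div_const ε)
    fun _ => ((R.continuous_fhat hs h ht).sub h.continuous_left).div_const ε

theorem measurable_varNorm_ghat (R : Run α β η bs m P) (hs : IsSchedule η bs m)
    (h : IsRegularPlan ε C α β fs gs κ Λ) (ht : 1 ≤ t) :
    Measurable fun ω => varNorm fun y => (R.ghat ε C t ω y - gs y) / ε :=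
  measurable_varNorm (fun y => ((R.measurable_ghat h ht y).sub_const _).div_const ε)
    fun _ => ((R.continuous_ghat hs h ht).sub h.continuous_right).div_const ε

theorem measurable_excess (R : Run α β η bs m P) (hs : IsSchedule η bs m)
    (h : IsRegularPlan ε C α β fs gs κ Λ) (ht : 1 ≤ t) : Measurable (R.excess ε C fs gs t) :=
  ((R.measurable_varNorm_fhat hs h ht).exp.max (R.measurable_varNorm_ghat hs h ht).exp).sub_const 1

theorem integrable_excess [Nonempty X] (R : Run α β η bs m P) (hs : IsSchedule η bs m)
    (h : IsRegularPlan ε C α β fs gs κ Λ) (ht : 1 ≤ t) : Integrable (R.excess ε C fs gs t) P :=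
  have : IsProbabilityMeasure P := R.indep_samples.isProbabilityMeasure
  .of_bound (R.measurable_excess hs h ht).aestronglyMeasurable (κ⁻¹ ^ 2 - 1)
    (.of_forall fun ω => by
      rw [Real.norm_of_nonneg (R.excess_nonneg hs h ht)]
      exact R.excess_le hs h ht)

theorem measurable_errorAt (R : Run α β η bs m P) (hs : IsSchedule η bs m)
    (h : IsRegularPlan ε C α β fs gs κ Λ) {N : ℕ} (ht : 1 ≤ firstIter bs N) :
    Measurable (R.errorAt ε C fs gs N) :=
  (R.measurable_varNorm_fhat hs h ht).add (R.measurable_varNorm_ghat hs h ht)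

theorem integrable_errorAt [Nonempty X] (R : Run α β η bs m P) (hs : IsSchedule η bs m)
    (h : IsRegularPlan ε C α β fs gs κ Λ) {N : ℕ} (ht : 1 ≤ firstIter bs N) :
    Integrable (R.errorAt ε C fs gs N) P := by
  refine ((R.integrable_excess hs h ht).const_mul 2).mono'
    (R.measurable_errorAt hs h ht).aestronglyMeasurable (.of_forall fun ω => ?_)
  have h₀ : 0 ≤ R.errorAt ε C fs gs N ω := add_nonneg
    (varNorm_sub_div_nonneg h.continuous_left (R.continuous_fhat hs h ht))
    (varNorm_sub_div_nonneg h.continuous_right (R.continuous_ghat hs h ht))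
  exact (Real.norm_of_nonneg h₀).trans_le (R.errorAt_le_excess N ω)

end Excess

end Run

namespace Run

variable {X : Type*} [MeasurableSpace X] {α β : Measure X} {η : ℕ → ℝ} {bs m : ℕ → ℕ} {Ω : Type*}
  [MeasurableSpace Ω] {P : Measure Ω} {ε κ Λ D B : ℝ} {C : X → X → ℝ} {fs gs : X → ℝ}
  {δ : ℕ → ℝ} {t : ℕ} {ω : Ω} [PseudoMetricSpace X] [CompactSpace X] [BorelSpace X]
  [IsProbabilityMeasure α] [IsProbabilityMeasure β]

section Recursion

theorem ratioLE_next (R : Run α β η bs m P) (hs : IsSchedule η bs m)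
    (h : IsRegularPlan ε C α β fs gs κ Λ) (hB : κ⁻¹ ^ 3 ≤ B) (ht : 1 ≤ t)
    (hpair : IsScalingPair κ B (relScaling ε fs (R.fhat ε C t ω))
      (relScaling ε gs (R.ghat ε C t ω))) (o : X) :
    RatioLE (relScaling ε fs (R.fnext ε C t ω))
        (1 + (R.excess ε C fs gs t ω * (1 - η t * contractionRate κ B) + η t * noiseGain κ B
          * (R.fnoise ε C fs gs o t ω + R.gnoise ε C fs gs o t ω))) ∧
      RatioLE (relScaling ε gs (R.gnext ε C t ω))
        (1 + (R.excess ε C fs gs t ω * (1 - η t * contractionRate κ B) + η t * noiseGain κ B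
          * (R.fnoise ε C fs gs o t ω + R.gnoise ε C fs gs o t ω))) := by
  have : Nonempty X := ⟨o⟩
  have hp := h.isMarkovDensity_left
  have hq := h.isMarkovDensity_right
  have hfhat := R.continuous_fhat (ω := ω) hs h ht
  have hghat := R.continuous_ghat (ω := ω) hs h ht
  have hfnext : Measurable (R.fnext ε C t ω) :=
    (measurable_fnextOfState h.continuous_cost.measurable).comp
      (g := Function.uncurry (fnextOfState ε C (η t)))
      (f := fun x => ((R.state t ω, R.ybatch t ω), x)) measurable_prodMk_left
  have hscaling {fs f : X → ℝ} (hfs : Continuous fs) (hf : Measurable f) :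
      Measurable (relScaling ε fs f) :=
    Real.measurable_exp.comp ((hfs.measurable.sub hf).div_const ε)
  rw [R.relScaling_gnext hs h.eps_pos.ne' ht]
  exact hpair.ratioLE_sinkhornUpdate_sinkhornUpdate hp hq hB (hs.nonneg ht) (hs.le_one ht)
    (hs.one_le_batch ht) (hscaling h.continuous_right hghat.measurable)
    (R.relScaling_fnext hs h.eps_pos.ne' ht) (hscaling h.continuous_left hfnext)
    (ratioLE_left_ratioExcess h.continuous_left hfhat)
    (ratioLE_right_ratioExcess h.continuous_right hghat) (R.excess_nonneg hs h ht)
    ((R.excess_le hs h ht).trans (sub_le_self _ zero_le_one))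
    (abs_empiricalDeviation_le_samplingNoise hp h.lipschitz_nonneg h.lipschitz_left
      h.continuous_right.measurable hghat.measurable hpair.ratioLE_right (hs.one_le_batch ht) o _)
    (abs_empiricalDeviation_le_samplingNoise hq h.lipschitz_nonneg h.lipschitz_right
      h.continuous_left.measurable hfnext (R.isScalingPair_next hs h hB ht hpair).ratioLE_left
      (hs.one_le_batch ht) o _)

theorem excess_succ_le (R : Run α β η bs m P) (hs : IsSchedule η bs m)
    (h : IsRegularPlan ε C α β fs gs κ Λ) (hB : κ⁻¹ ^ 3 ≤ B) (hδ : 0 ≤ δ t)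
    (hcomp : R.CompressionLE ε C δ ω) (ht : 1 ≤ t)
    (hpair : IsScalingPair κ B (relScaling ε fs (R.fhat ε C t ω))
      (relScaling ε gs (R.ghat ε C t ω))) (o : X) :
    R.excess ε C fs gs (t + 1) ω
      ≤ R.excess ε C fs gs t ω * (1 - η t * contractionRate κ B) + η t * noiseGain κ B
          * (R.fnoise ε C fs gs o t ω + R.gnoise ε C fs gs o t ω)
        + (Real.exp (2 * δ t) - 1) * κ⁻¹ ^ 2 := by
  have : Nonempty X := ⟨o⟩
  have hnext := R.isScalingPair_next hs h hB ht hpair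
  obtain ⟨hf, hg⟩ := R.ratioLE_next hs h hB ht hpair o
  have hfδ (x : X) := relScaling_le_of_abs_sub_le (fs := fs) h.eps_pos ((hcomp t ht).1 x)
  have hgδ (y : X) := relScaling_le_of_abs_sub_le (fs := gs) h.eps_pos ((hcomp t ht).2 y)
  have hf' := hf.of_perturbation hnext.ratioLE_left relScaling_pos hδ (fun x => (hfδ x).1)
    fun x => (hfδ x).2
  have hg' := hg.of_perturbation hnext.ratioLE_right relScaling_pos hδ (fun y => (hgδ y).1)
    fun y => (hgδ y).2
  exact (ratioExcess_le hf' hg').trans_eq (by ring)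

theorem integral_excess_succ_le (R : Run α β η bs m P) (hs : IsSchedule η bs m)
    (hX : HasDyadicNets X D) (hD : 0 < D) (h : IsRegularPlan ε C α β fs gs κ Λ)
    (hB : κ⁻¹ ^ 3 ≤ B) (hδ : 0 ≤ δ t) (hcomp : ∀ᵐ ω ∂P, R.CompressionLE ε C δ ω) (ht : 1 ≤ t)
    (hpair : ∀ᵐ ω ∂P, IsScalingPair κ B (relScaling ε fs (R.fhat ε C t ω))
      (relScaling ε gs (R.ghat ε C t ω))) :
    ∫ ω, R.excess ε C fs gs (t + 1) ω ∂P
      ≤ (∫ ω, R.excess ε C fs gs t ω ∂P) * (1 - η t * contractionRate κ B)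
        + η t * noiseGain κ B * (2 * noiseConst κ Λ D / √(bs t))
        + (Real.exp (2 * δ t) - 1) * κ⁻¹ ^ 2 := by
  have : IsProbabilityMeasure P := R.indep_samples.isProbabilityMeasure
  obtain ⟨o⟩ : Nonempty X := α.nonempty_of_neZero
  have : Nonempty X := ⟨o⟩
  have hgain : 0 ≤ η t * noiseGain κ B := by
    have hκ := h.isMarkovDensity_left.pos
    have : 0 ≤ B := (pow_nonneg (inv_nonneg.2 hκ.le) 3).trans hB
    exact mul_nonneg (hs.nonneg ht) (by unfold noiseGain; positivity)
  have hexcess := (R.integrable_excess hs h ht).mul_const (1 - η t * contractionRate κ B)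
  have hf := R.integrable_fnoise hs h ht o
  have hg := R.integrable_gnoise hs h ht o
  have hnoise := (hf.fun_add hg).const_mul (η t * noiseGain κ B)
  calc ∫ ω, R.excess ε C fs gs (t + 1) ω ∂P
      ≤ ∫ ω, (R.excess ε C fs gs t ω * (1 - η t * contractionRate κ B) + η t * noiseGain κ B
          * (R.fnoise ε C fs gs o t ω + R.gnoise ε C fs gs o t ω)
        + (Real.exp (2 * δ t) - 1) * κ⁻¹ ^ 2) ∂P := by
        refine integral_mono_ae (R.integrable_excess hs h t.succ_pos)
          ((hexcess.fun_add hnoise).fun_add (integrable_const _)) ?_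
        filter_upwards [hcomp, hpair] with ω hω hω'
        exact R.excess_succ_le hs h hB hδ hω ht hω' o
    _ = (∫ ω, R.excess ε C fs gs t ω ∂P) * (1 - η t * contractionRate κ B)
        + η t * noiseGain κ B
          * (∫ ω, R.fnoise ε C fs gs o t ω ∂P + ∫ ω, R.gnoise ε C fs gs o t ω ∂P)
        + (Real.exp (2 * δ t) - 1) * κ⁻¹ ^ 2 := by
        rw [integral_add (hexcess.fun_add hnoise) (integrable_const _), integral_add hexcess hnoise,
          integral_mul_const, integral_const_mul, integral_add hf hg, integral_const,
          probReal_univ, one_smul]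
    _ ≤ _ := by
        gcongr
        linarith [R.integral_fnoise_le hs hX hD h ht o, R.integral_gnoise_le hs hX hD h ht o,
          mul_div_assoc 2 (noiseConst κ Λ D) √(bs t)]

end Recursion

end Run

section Rates

variable {a b c : ℝ}

theorem rpow_neg_mul_one_sub_div_le {x : ℝ} (ha : 0 ≤ a) (hx : 0 < x) :
    x ^ (-a) * (1 - a / x) ≤ (x + 1) ^ (-a) := by
  have hlog : a * Real.log (1 + 1 / x) ≤ a / x := by
    rw [div_eq_mul_one_div a]
    gcongr
    linarith [Real.log_le_sub_one_of_pos (by positivity : 0 < 1 + 1 / x)]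
  calc x ^ (-a) * (1 - a / x) ≤ x ^ (-a) * Real.exp (Real.log (1 + 1 / x) * -a) := by
        gcongr
        linarith [Real.add_one_le_exp (Real.log (1 + 1 / x) * -a)]
    _ = (x * (1 + 1 / x)) ^ (-a) := by
        rw [Real.mul_rpow hx.le (by positivity),
          Real.rpow_def_of_pos (by positivity : 0 < 1 + 1 / x)]
    _ = (x + 1) ^ (-a) := by rw [mul_add, mul_one, mul_one_div_cancel hx.ne']

theorem eventually_div_le_mul_rpow (a : ℝ) (hb : -1 < b) (hc : 0 < c) :
    ∀ᶠ t : ℕ in Filter.atTop, a / t ≤ c * (t : ℝ) ^ b := by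
  have hlim : Filter.Tendsto (fun t : ℕ => a * (t : ℝ) ^ (-(1 + b))) Filter.atTop (nhds 0) := by
    simpa using ((tendsto_rpow_neg_atTop (by linarith : 0 < 1 + b)).comp
      tendsto_natCast_atTop_atTop).const_mul a
  filter_upwards [hlim.eventually (ge_mem_nhds hc), Filter.eventually_gt_atTop 0] with t ht ht₀
  have ht₀ : (0 : ℝ) < t := by exact_mod_cast ht₀
  calc a / t = a * (t : ℝ) ^ (-(1 + b)) * (t : ℝ) ^ b := by
        rw [mul_assoc, ← Real.rpow_add ht₀, neg_add_rev, neg_add_cancel_comm, Real.rpow_neg_one,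
          div_eq_mul_inv]
    _ ≤ _ := by gcongr

theorem mul_rpow_neg_add_le {A G x : ℝ} (ha : 0 ≤ a) (hA : 0 ≤ A) (hx : 0 < x)
    (hG : G ≤ c / 2 * A) (hax : a / x ≤ c / 2 * x ^ b) :
    (1 - c * x ^ b) * (A * x ^ (-a)) + G * x ^ (b - a) ≤ A * (x + 1) ^ (-a) :=
  calc (1 - c * x ^ b) * (A * x ^ (-a)) + G * x ^ (b - a)
      ≤ (1 - c * x ^ b) * (A * x ^ (-a)) + c / 2 * A * (x ^ b * x ^ (-a)) := by
        rw [← Real.rpow_add hx, ← sub_eq_add_neg]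
        gcongr
    _ = A * (x ^ (-a) * (1 - c / 2 * x ^ b)) := by ring
    _ ≤ A * (x ^ (-a) * (1 - a / x)) := by gcongr
    _ ≤ _ := by gcongr; exact rpow_neg_mul_one_sub_div_le ha hx

theorem exists_forall_le_rpow_of_recursion {G M : ℝ} (ha : 0 ≤ a) (hb : -1 < b) (hb₀ : b ≤ 0)
    (hc : 0 < c) (hc₁ : c ≤ 1) (hG : 0 ≤ G) (hM : 0 ≤ M) :
    ∃ A : ℝ, 0 < A ∧ ∀ d : ℕ → ℝ, (∀ t : ℕ, 1 ≤ t → d t ≤ M) →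
      (∀ t : ℕ, 1 ≤ t → d (t + 1) ≤ (1 - c * (t : ℝ) ^ b) * d t + G * (t : ℝ) ^ (b - a)) →
      ∀ t : ℕ, 1 ≤ t → d t ≤ A * (t : ℝ) ^ (-a) := by
  obtain ⟨t₀, ht₀⟩ := Filter.eventually_atTop.1 (eventually_div_le_mul_rpow a hb (half_pos hc))
  set A := 2 * G / c + M * ((t₀ : ℝ) + 1) ^ a + 1
  have hA₀ : 0 < A := by positivity
  have hGA : G ≤ c / 2 * A := by
    have : G = c / 2 * (2 * G / c) := by field_simp
    rw [this]
    gcongr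
    linarith [mul_nonneg hM (Real.rpow_nonneg (by positivity : 0 ≤ (t₀ : ℝ) + 1) a)]
  refine ⟨A, hA₀, fun d hdM hd t ht => ?_⟩
  have hinit : ∀ t : ℕ, 1 ≤ t → t ≤ t₀ + 1 → d t ≤ A * (t : ℝ) ^ (-a) := fun t ht htt₀ => by
    have htt₀ : (t : ℝ) ≤ t₀ + 1 := by exact_mod_cast htt₀
    rw [Real.rpow_neg t.cast_nonneg, ← div_eq_mul_inv, le_div_iff₀ (by positivity)]
    calc d t * (t : ℝ) ^ a ≤ M * ((t₀ : ℝ) + 1) ^ a := by gcongr; exact hdM t ht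
      _ ≤ A := by linarith [div_nonneg (mul_nonneg zero_le_two hG) hc.le]
  induction t, ht using Nat.le_induction with
  | base => exact hinit 1 le_rfl (Nat.le_add_left 1 t₀)
  | succ t ht ih =>
    rcases le_or_gt (t + 1) (t₀ + 1) with htt₀ | htt₀
    · exact hinit _ t.succ_pos htt₀
    have ht₁ : (1 : ℝ) ≤ t := by exact_mod_cast ht
    have hfactor : 0 ≤ 1 - c * (t : ℝ) ^ b := sub_nonneg.2
      (mul_le_one₀ hc₁ (by positivity) (Real.rpow_le_one_of_one_le_of_nonpos ht₁ hb₀))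
    push_cast
    calc d (t + 1) ≤ (1 - c * (t : ℝ) ^ b) * d t + G * (t : ℝ) ^ (b - a) := hd t ht
      _ ≤ (1 - c * (t : ℝ) ^ b) * (A * (t : ℝ) ^ (-a)) + G * (t : ℝ) ^ (b - a) := by gcongr
      _ ≤ _ := mul_rpow_neg_add_le ha hA₀.le (by linarith) hGA (ht₀ t (by omega))

theorem exists_exp_neg_rpow_le {γ : ℝ} (hγ : 0 < γ) (q : ℝ) :
    ∃ E : ℝ, 0 < E ∧ ∀ x : ℝ, 1 ≤ x → Real.exp (-x ^ γ) ≤ E * x ^ (-q) := by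
  obtain ⟨n, hn⟩ := exists_nat_ge (q / γ)
  refine ⟨n.factorial, by exact_mod_cast n.factorial_pos, fun x hx => ?_⟩
  have hx₀ : 0 < x := by linarith
  have hf : (0 : ℝ) < n.factorial := by exact_mod_cast n.factorial_pos
  have hpow : x ^ q ≤ n.factorial * Real.exp (x ^ γ) :=
    calc x ^ q ≤ x ^ (γ * n) := Real.rpow_le_rpow_of_exponent_le hx ((div_le_iff₀' hγ).1 hn)
      _ = (x ^ γ) ^ n := Real.rpow_mul_natCast hx₀.le γ n
      _ ≤ _ := (div_le_iff₀' hf).1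
        (Real.pow_div_factorial_le_exp _ (Real.rpow_nonneg hx₀.le γ) n)
  rwa [Real.exp_neg, Real.rpow_neg hx₀.le, ← div_eq_mul_inv, inv_eq_one_div,
    div_le_div_iff₀ (Real.exp_pos _) (by positivity), one_mul]

theorem exp_sub_one_le (x : ℝ) : Real.exp x - 1 ≤ x * Real.exp x := by
  have hinv : Real.exp x * Real.exp (-x) = 1 := by
    rw [← Real.exp_add, add_neg_cancel, Real.exp_zero]
  nlinarith [mul_le_mul_of_nonneg_left (Real.one_sub_le_exp_neg x) (Real.exp_pos x).le]

theorem exp_mul_sub_one_le {x u : ℝ} (hx : 0 ≤ x) (hu₀ : 0 ≤ u) (hu₁ : u ≤ 1) :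
    Real.exp (x * u) - 1 ≤ x * Real.exp x * u :=
  calc Real.exp (x * u) - 1 ≤ x * u * Real.exp (x * u) := exp_sub_one_le _
    _ ≤ x * u * Real.exp x := by
        gcongr
        exact mul_le_of_le_one_right hx hu₁
    _ = x * Real.exp x * u := mul_right_comm ..

end Rates

section Schedule

variable {a b ζ : ℝ} {t : ℕ}

theorem one_le_batchSize (a : ℝ) (s : ℕ) (ht : 1 ≤ t) : 1 ≤ batchSize a s t :=
  Nat.one_le_ceil_iff.2 (Real.rpow_pos_of_pos (by exact_mod_cast (by omega : 0 < t + s)) _)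

theorem rpow_le_sqrt_batchSize (ha : 0 ≤ a) (s t : ℕ) : (t : ℝ) ^ a ≤ √(batchSize a s t) := by
  refine Real.le_sqrt_of_sq_le ?_
  calc ((t : ℝ) ^ a) ^ 2 = (t : ℝ) ^ (2 * a) := by
        rw [← Real.rpow_mul_natCast t.cast_nonneg, mul_comm]; norm_num
    _ ≤ ((t + s : ℕ) : ℝ) ^ (2 * a) := by gcongr; omega
    _ ≤ _ := Nat.le_ceil _

theorem stepSize_le_one (hb : b ≤ 0) (s : ℕ) (ht : 1 ≤ t) : stepSize b s t ≤ 1 :=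
  Real.rpow_le_one_of_one_le_of_nonpos (by exact_mod_cast (by omega : 1 ≤ t + s)) hb

theorem stepSize_le_rpow (hb : b ≤ 0) (s : ℕ) (ht : 1 ≤ t) : stepSize b s t ≤ (t : ℝ) ^ b :=
  Real.rpow_le_rpow_of_nonpos (by exact_mod_cast ht) (by exact_mod_cast Nat.le_add_right t s) hb

theorem stepSize_mul_div_sqrt_batchSize_le {G : ℝ} (ha : 0 ≤ a) (hb : b ≤ 0) (hG : 0 ≤ G) (s : ℕ)
    (ht : 1 ≤ t) :
    stepSize b s t * (G / √(batchSize a s t)) ≤ G * (t : ℝ) ^ (b - a) := by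
  have ht₀ : (0 : ℝ) < t := by exact_mod_cast ht
  calc stepSize b s t * (G / √(batchSize a s t)) ≤ (t : ℝ) ^ b * (G / (t : ℝ) ^ a) := by
        gcongr
        · exact stepSize_le_rpow hb s ht
        · exact rpow_le_sqrt_batchSize ha s t
    _ = _ := by rw [Real.rpow_sub ht₀]; ring

theorem le_stepSize (hb : b ≤ 0) (s : ℕ) (ht : 1 ≤ t) :
    ((s : ℝ) + 1) ^ b * (t : ℝ) ^ b ≤ stepSize b s t := by
  rw [← Real.mul_rpow (by positivity) (by positivity)]
  refine Real.rpow_le_rpow_of_nonpos (by exact_mod_cast Nat.add_pos_left ht s) ?_ hb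
  exact_mod_cast (by nlinarith : t + s ≤ (s + 1) * t)

theorem one_le_compressionSize (a b ζ : ℝ) (s : ℕ) (ht : 1 ≤ t) :
    1 ≤ compressionSize a b ζ s t := by
  unfold compressionSize
  split_ifs
  · exact one_le_batchSize a s le_rfl
  · exact Nat.one_le_ceil_iff.2 (Real.rpow_pos_of_pos (by exact_mod_cast ht) _)

theorem isSchedule_stepSize (a ζ : ℝ) (hb : b ≤ 0) (s : ℕ) :
    IsSchedule (stepSize b s) (batchSize a s) (compressionSize a b ζ s) where
  nonneg _ := Real.rpow_nonneg (Nat.cast_nonneg _) b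
  le_one ht := stepSize_le_one hb s ht
  one_le_batch ht := one_le_batchSize a s ht
  one_le_size ht := one_le_compressionSize a b ζ s ht

theorem compressionSize_rpow_le (hζ : 0 < ζ) (hab : b ≤ a) (s : ℕ) (ht : 1 ≤ t) :
    (compressionSize a b ζ s (t + 1) : ℝ) ^ (-ζ) ≤ (t : ℝ) ^ (b - a) := by
  have ht₀ : (0 : ℝ) < t := by exact_mod_cast ht
  have hsize : (t : ℝ) ^ ((a - b) / ζ) ≤ compressionSize a b ζ s (t + 1) := by
    rw [compressionSize, if_neg (by omega)]
    refine le_trans ?_ (Nat.le_ceil _)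
    gcongr
    exact t.le_succ
  calc (compressionSize a b ζ s (t + 1) : ℝ) ^ (-ζ) ≤ ((t : ℝ) ^ ((a - b) / ζ)) ^ (-ζ) :=
        Real.rpow_le_rpow_of_nonpos (by positivity) hsize (by linarith)
    _ = (t : ℝ) ^ (b - a) := by
        rw [← Real.rpow_mul ht₀.le, mul_neg, div_mul_cancel₀ _ hζ.ne', neg_sub]

theorem batchSize_le (ha : 0 ≤ a) (s : ℕ) {i : ℕ} (hi : 1 ≤ i) (hit : i ≤ t) :
    (batchSize a s i : ℝ) ≤ 2 * (((s : ℝ) + 1) ^ (2 * a) * (t : ℝ) ^ (2 * a)) := by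
  have hpow : 1 ≤ ((i + s : ℕ) : ℝ) ^ (2 * a) :=
    Real.one_le_rpow (by exact_mod_cast (by omega : 1 ≤ i + s)) (by linarith)
  calc (batchSize a s i : ℝ) ≤ ((i + s : ℕ) : ℝ) ^ (2 * a) + 1 :=
        (Nat.ceil_lt_add_one (zero_le_one.trans hpow)).le
    _ ≤ 2 * ((i + s : ℕ) : ℝ) ^ (2 * a) := by linarith
    _ ≤ 2 * (((s : ℝ) + 1) * t) ^ (2 * a) := by
        gcongr
        exact_mod_cast (by nlinarith : i + s ≤ (s + 1) * t)
    _ = _ := by rw [Real.mul_rpow (by positivity) (by positivity)]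

theorem sum_batchSize_le (ha : 0 ≤ a) (s : ℕ) (ht : 1 ≤ t) :
    ((∑ i ∈ Finset.Icc 1 t, batchSize a s i : ℕ) : ℝ)
      ≤ 2 * ((s : ℝ) + 1) ^ (2 * a) * (t : ℝ) ^ (2 * a + 1) := by
  have ht₀ : (0 : ℝ) < t := by exact_mod_cast ht
  push_cast
  calc ∑ i ∈ Finset.Icc 1 t, (batchSize a s i : ℝ)
      ≤ ∑ _i ∈ Finset.Icc 1 t, 2 * (((s : ℝ) + 1) ^ (2 * a) * (t : ℝ) ^ (2 * a)) :=
        Finset.sum_le_sum fun i hi =>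
          batchSize_le ha s (Finset.mem_Icc.1 hi).1 (Finset.mem_Icc.1 hi).2
    _ = _ := by
        rw [Finset.sum_const, Nat.card_Icc, nsmul_eq_mul, Real.rpow_add ht₀, Real.rpow_one,
          Nat.add_sub_cancel]
        ring

theorem lt_sum_firstIter {bs : ℕ → ℕ} (hbs : ∀ t, 1 ≤ t → 1 ≤ bs t) (N : ℕ) :
    N < ∑ i ∈ Finset.Icc 1 (Run.firstIter bs N), bs i := by
  refine Nat.sInf_mem (s := {t | N < ∑ i ∈ Finset.Icc 1 t, bs i}) ⟨N + 1, ?_⟩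
  calc N < ∑ _i ∈ Finset.Icc 1 (N + 1), 1 := by simp
    _ ≤ _ := Finset.sum_le_sum fun i hi => hbs i (Finset.mem_Icc.1 hi).1

theorem one_le_firstIter {bs : ℕ → ℕ} (hbs : ∀ t, 1 ≤ t → 1 ≤ bs t) (N : ℕ) :
    1 ≤ Run.firstIter bs N := by
  by_contra! h
  simpa [Nat.lt_one_iff.1 h] using lt_sum_firstIter hbs N

theorem firstIter_rpow_le (ha : 0 < a) (s : ℕ) {N : ℕ} (hN : 1 ≤ N) :
    (Run.firstIter (batchSize a s) N : ℝ) ^ (-a)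
      ≤ (2 * ((s : ℝ) + 1) ^ (2 * a)) ^ (a / (2 * a + 1)) * (N : ℝ) ^ (-(a / (2 * a + 1))) := by
  have hbs : ∀ t, 1 ≤ t → 1 ≤ batchSize a s t := fun t ht => one_le_batchSize a s ht
  have hlt := lt_sum_firstIter hbs N
  have hT := one_le_firstIter hbs N
  set T := Run.firstIter (batchSize a s) N
  set S := 2 * ((s : ℝ) + 1) ^ (2 * a)
  have hN₀ : (0 : ℝ) < N := by exact_mod_cast hN
  have hT₀ : (0 : ℝ) < T := by exact_mod_cast hT
  have hpow : (N : ℝ) ^ (a / (2 * a + 1)) ≤ S ^ (a / (2 * a + 1)) * (T : ℝ) ^ a :=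
    calc (N : ℝ) ^ (a / (2 * a + 1)) ≤ (S * (T : ℝ) ^ (2 * a + 1)) ^ (a / (2 * a + 1)) := by
          gcongr
          exact (Nat.cast_le.2 hlt.le).trans (sum_batchSize_le ha.le s hT)
      _ = _ := by
          rw [Real.mul_rpow (by positivity) (by positivity), ← Real.rpow_mul hT₀.le,
            mul_div_cancel₀ a (by positivity)]
  rwa [Real.rpow_neg hT₀.le, Real.rpow_neg hN₀.le, ← div_eq_mul_inv, inv_eq_one_div,
    div_le_div_iff₀ (by positivity) (by positivity), one_mul]

end Schedule

namespace Run

variable {X : Type*} [MeasurableSpace X] {α β : Measure X} {a b ζ ε κ Λ D B K Δ : ℝ} {s t : ℕ}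
  {Ω : Type*} [MeasurableSpace Ω] {P : Measure Ω} {C : X → X → ℝ} {fs gs : X → ℝ}
  {R : Run α β (stepSize b s) (batchSize a s) (compressionSize a b ζ s) P}

section Convergence

theorem CompressionErrorBound.ae_compressionLE (hR : R.CompressionErrorBound ε C ζ K)
    (hε : 0 < ε) (hζ : 0 < ζ) (hab : b ≤ a) :
    ∀ᵐ ω ∂P, R.CompressionLE ε C (fun t => |K| / ε * (t : ℝ) ^ (b - a)) ω := by
  filter_upwards [hR] with ω hω t ht
  have hK : K * (compressionSize a b ζ s (t + 1) : ℝ) ^ (-ζ)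
      ≤ ε * (|K| / ε * (t : ℝ) ^ (b - a)) := by
    rw [← mul_assoc, mul_div_cancel₀ _ hε.ne']
    gcongr
    · exact le_abs_self K
    · exact compressionSize_rpow_le hζ hab s ht
  exact ⟨fun x => ((hω t ht).1 x).trans hK, fun y => ((hω t ht).2 y).trans hK⟩

variable [PseudoMetricSpace X] [CompactSpace X]

theorem exists_ae_isScalingPair (h : IsRegularPlan ε C α β fs gs κ Λ) (hb : b ≤ 0) (hab : 1 < a - b)
    (hζ : 0 < ζ) (K : ℝ) (s : ℕ) :
    ∃ B, κ⁻¹ ^ 3 ≤ B ∧ ∀ (Ω : Type*) [MeasurableSpace Ω] (P : Measure Ω)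
      (R : Run α β (stepSize b s) (batchSize a s) (compressionSize a b ζ s) P),
      R.CompressionErrorBound ε C ζ K → ∀ᵐ ω ∂P, ∀ t : ℕ, 1 ≤ t →
        IsScalingPair κ B (relScaling ε fs (R.fhat ε C t ω))
          (relScaling ε gs (R.ghat ε C t ω)) := by
  have hε := h.eps_pos
  have hcost : Continuous fun z : X × X => C z.1 z.2 := h.continuous_cost
  obtain ⟨F, hF⟩ := exists_abs_le_of_continuous (Z := X × X)
    (f := fun z => (fs z.1 - C z.1 z.2) / ε)
    (((h.continuous_left.comp continuous_fst).sub hcost).div_const ε)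
  obtain ⟨G, hG⟩ := exists_abs_le_of_continuous (Z := X × X)
    (f := fun z => (gs z.2 - C z.1 z.2) / ε)
    (((h.continuous_right.comp continuous_snd).sub hcost).div_const ε)
  set δ : ℕ → ℝ := fun t => |K| / ε * (t : ℝ) ^ (b - a)
  have hδ (t : ℕ) : 0 ≤ δ t := by positivity
  have hδ_sum : Summable δ := (Real.summable_nat_rpow.2 (by linarith)).mul_left _
  refine ⟨scaleBound κ (max F G) (∑' t, δ t) (compressionSize a b ζ s 1),
    le_scaleBound h.isMarkovDensity_left.pos (tsum_nonneg hδ), fun Ω _ P R hR => ?_⟩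
  filter_upwards [hR.ae_compressionLE hε hζ (by linarith)] with ω hω t ht
  exact R.isScalingPair_scaleBound (isSchedule_stepSize a ζ hb s) h
    (fun x y => (hF (x, y)).trans (le_max_left _ _))
    (fun x y => (hG (x, y)).trans (le_max_right _ _)) hδ
    (fun t => hδ_sum.sum_le_tsum _ fun i _ => hδ i) hω ht

variable [BorelSpace X] [IsProbabilityMeasure α] [IsProbabilityMeasure β]

theorem integral_excess_succ_le_rpow (hX : HasDyadicNets X D) (hD : 0 < D)
    (h : IsRegularPlan ε C α β fs gs κ Λ) (ha : 0 ≤ a) (hb : b ≤ 0) (hB : κ⁻¹ ^ 3 ≤ B)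
    (hΔ : 0 ≤ Δ) (hcomp : ∀ᵐ ω ∂P, R.CompressionLE ε C (fun t => Δ * (t : ℝ) ^ (b - a)) ω)
    (ht : 1 ≤ t) (hpair : ∀ᵐ ω ∂P, IsScalingPair κ B (relScaling ε fs (R.fhat ε C t ω))
      (relScaling ε gs (R.ghat ε C t ω))) :
    ∫ ω, R.excess ε C fs gs (t + 1) ω ∂P
      ≤ (1 - ((s : ℝ) + 1) ^ b * contractionRate κ B * (t : ℝ) ^ b)
          * ∫ ω, R.excess ε C fs gs t ω ∂P
        + (noiseGain κ B * (2 * noiseConst κ Λ D) + 2 * Δ * Real.exp (2 * Δ) * κ⁻¹ ^ 2)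
          * (t : ℝ) ^ (b - a) := by
  have hs := isSchedule_stepSize a ζ hb s
  have hκ := h.isMarkovDensity_left.pos
  have hΛ := h.lipschitz_nonneg
  have hB₀ : 0 < B := lt_of_lt_of_le (by positivity) hB
  have : Nonempty X := α.nonempty_of_neZero
  have hexcess : 0 ≤ ∫ ω, R.excess ε C fs gs t ω ∂P :=
    integral_nonneg fun ω => R.excess_nonneg hs h ht
  have hgain : 0 ≤ noiseGain κ B := by unfold noiseGain; positivity
  have hcontraction : ((s : ℝ) + 1) ^ b * contractionRate κ B * (t : ℝ) ^ b
      ≤ stepSize b s t * contractionRate κ B := by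
    rw [mul_right_comm]
    exact mul_le_mul_of_nonneg_right (le_stepSize hb s ht) (by unfold contractionRate; positivity)
  have hnoise : stepSize b s t * (2 * noiseConst κ Λ D / √(batchSize a s t))
      ≤ 2 * noiseConst κ Λ D * (t : ℝ) ^ (b - a) :=
    stepSize_mul_div_sqrt_batchSize_le ha hb (by unfold noiseConst; positivity) s ht
  have hcompression : Real.exp (2 * Δ * (t : ℝ) ^ (b - a)) - 1
      ≤ 2 * Δ * Real.exp (2 * Δ) * (t : ℝ) ^ (b - a) :=
    exp_mul_sub_one_le (by positivity) (by positivity)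
      (Real.rpow_le_one_of_one_le_of_nonpos (by exact_mod_cast ht) (by linarith))
  calc ∫ ω, R.excess ε C fs gs (t + 1) ω ∂P
      ≤ (∫ ω, R.excess ε C fs gs t ω ∂P) * (1 - stepSize b s t * contractionRate κ B)
        + stepSize b s t * noiseGain κ B * (2 * noiseConst κ Λ D / √(batchSize a s t))
        + (Real.exp (2 * (Δ * (t : ℝ) ^ (b - a))) - 1) * κ⁻¹ ^ 2 :=
        R.integral_excess_succ_le hs hX hD h hB (by positivity) hcomp ht hpair
    _ = (1 - stepSize b s t * contractionRate κ B) * (∫ ω, R.excess ε C fs gs t ω ∂P)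
        + noiseGain κ B * (stepSize b s t * (2 * noiseConst κ Λ D / √(batchSize a s t)))
        + (Real.exp (2 * Δ * (t : ℝ) ^ (b - a)) - 1) * κ⁻¹ ^ 2 := by
        rw [mul_assoc 2 Δ]
        ring
    _ ≤ (1 - ((s : ℝ) + 1) ^ b * contractionRate κ B * (t : ℝ) ^ b)
          * (∫ ω, R.excess ε C fs gs t ω ∂P)
        + noiseGain κ B * (2 * noiseConst κ Λ D * (t : ℝ) ^ (b - a))
        + 2 * Δ * Real.exp (2 * Δ) * (t : ℝ) ^ (b - a) * κ⁻¹ ^ 2 := by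
        gcongr
    _ = _ := by ring

theorem exists_integral_excess_le (hX : HasDyadicNets X D) (hD : 0 < D)
    (h : IsRegularPlan ε C α β fs gs κ Λ) (ha : 0 ≤ a) (hb : -1 < b) (hb₀ : b ≤ 0)
    (hab : 1 < a - b) (hζ : 0 < ζ) (K : ℝ) (s : ℕ) :
    ∃ A : ℝ, 0 < A ∧ ∀ (Ω : Type*) [MeasurableSpace Ω] (P : Measure Ω)
      (R : Run α β (stepSize b s) (batchSize a s) (compressionSize a b ζ s) P),
      R.CompressionErrorBound ε C ζ K →
        ∀ t : ℕ, 1 ≤ t → ∫ ω, R.excess ε C fs gs t ω ∂P ≤ A * (t : ℝ) ^ (-a) := by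
  have hs := isSchedule_stepSize a ζ hb₀ s
  have hε := h.eps_pos
  have hκ := h.isMarkovDensity_left.pos
  have hΛ := h.lipschitz_nonneg
  have : Nonempty X := α.nonempty_of_neZero
  obtain ⟨B, hB, hpair⟩ := exists_ae_isScalingPair h hb₀ hab hζ K s
  have hB₀ : 0 < B := lt_of_lt_of_le (by positivity) hB
  set c := ((s : ℝ) + 1) ^ b * contractionRate κ B
  have hc : 0 < c := mul_pos (by positivity) (by unfold contractionRate; positivity)
  have hc₁ : c ≤ 1 := mul_le_one₀
    (Real.rpow_le_one_of_one_le_of_nonpos (by linarith [s.cast_nonneg (α := ℝ)]) hb₀)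
    (by unfold contractionRate; positivity)
    (contractionRate_le_one hκ h.isMarkovDensity_left.le_one hB)
  set Δ := |K| / ε
  have hΔ : 0 ≤ Δ := by positivity
  obtain ⟨A, hA, hle⟩ := exists_forall_le_rpow_of_recursion (M := κ⁻¹ ^ 2)
    (G := noiseGain κ B * (2 * noiseConst κ Λ D) + 2 * Δ * Real.exp (2 * Δ) * κ⁻¹ ^ 2)
    ha hb hb₀ hc hc₁ (by unfold noiseGain noiseConst; positivity) (by positivity)
  refine ⟨A, hA, fun Ω _ P R hR => hle _ (fun t ht => ?_) fun t ht => ?_⟩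
  · have : IsProbabilityMeasure P := R.indep_samples.isProbabilityMeasure
    calc ∫ ω, R.excess ε C fs gs t ω ∂P ≤ ∫ _ω, κ⁻¹ ^ 2 ∂P :=
          integral_mono (R.integrable_excess hs h ht) (integrable_const _) fun ω =>
            (R.excess_le hs h ht).trans (sub_le_self _ zero_le_one)
      _ = κ⁻¹ ^ 2 := by rw [integral_const, probReal_univ, one_smul]
  · exact R.integral_excess_succ_le_rpow hX hD h ha hb₀ hB hΔ
      (hR.ae_compressionLE hε hζ (by linarith)) ht
      ((hpair Ω P R hR).mono fun ω hω => hω t ht)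

theorem exists_integral_errorAt_le (hX : HasDyadicNets X D) (hD : 0 < D)
    (h : IsRegularPlan ε C α β fs gs κ Λ) (ha : 0 < a) (hb : -1 < b) (hb₀ : b ≤ 0)
    (hab : 1 < a - b) (hζ : 0 < ζ) (K : ℝ) (s : ℕ) :
    ∃ A : ℝ, 0 < A ∧ ∀ (Ω : Type*) [MeasurableSpace Ω] (P : Measure Ω)
      (R : Run α β (stepSize b s) (batchSize a s) (compressionSize a b ζ s) P),
      R.CompressionErrorBound ε C ζ K → ∀ N : ℕ, 1 ≤ N → Integrable (R.errorAt ε C fs gs N) P ∧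
        ∫ ω, R.errorAt ε C fs gs N ω ∂P ≤ A * (N : ℝ) ^ (-(a / (2 * a + 1))) := by
  obtain ⟨A, hA, hle⟩ := exists_integral_excess_le hX hD h ha.le hb hb₀ hab hζ K s
  have hs := isSchedule_stepSize a ζ hb₀ s
  have : Nonempty X := α.nonempty_of_neZero
  set S := (2 * ((s : ℝ) + 1) ^ (2 * a)) ^ (a / (2 * a + 1))
  refine ⟨2 * A * S, by positivity, fun Ω _ P R hR N hN => ?_⟩
  have hT := one_le_firstIter (fun _ ht => one_le_batchSize a s ht) N
  have hint := R.integrable_errorAt hs h hT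
  refine ⟨hint, ?_⟩
  set T := firstIter (batchSize a s) N
  calc ∫ ω, R.errorAt ε C fs gs N ω ∂P ≤ ∫ ω, 2 * R.excess ε C fs gs T ω ∂P :=
        integral_mono hint ((R.integrable_excess hs h hT).const_mul 2) (R.errorAt_le_excess N)
    _ = 2 * ∫ ω, R.excess ε C fs gs T ω ∂P := integral_const_mul ..
    _ ≤ 2 * (A * (T : ℝ) ^ (-a)) := by gcongr; exact hle Ω P R hR T hT
    _ ≤ 2 * (A * (S * (N : ℝ) ^ (-(a / (2 * a + 1))))) := by
        gcongr
        exact firstIter_rpow_le ha s hN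
    _ = _ := by ring

end Convergence

end Run

end

end COS

theorem theorem2_general {X : Type*} [PseudoMetricSpace X] [CompactSpace X] [MeasurableSpace X]
    [BorelSpace X] {D : ℝ} (hX : COS.HasDyadicNets X D) (hD : 0 < D) (α β : Measure X)
    [IsProbabilityMeasure α] [IsProbabilityMeasure β]
    (C : X → X → ℝ) (L : ℝ≥0) (hC : LipschitzWith L (Function.uncurry C))
    (ε : ℝ) (hε : 0 < ε)
    (fs gs : X → ℝ) (hopt : COS.IsOptimalPotentials ε C α β fs gs)
    (a b : ℝ) (hb : -1 < b) (hb₀ : b ≤ 0) (hab : 1 < a - b)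
    (ζ : ℝ) (hζ : 0 < ζ) (K : ℝ) (s : ℕ) :
    ∃ c : ℝ, 0 < c ∧ ∃ A : ℝ, 0 < A ∧ ∃ B : ℝ, 0 < B ∧
      ∀ (Ω : Type*) [MeasurableSpace Ω] (P : Measure Ω) [IsProbabilityMeasure P]
        (R : COS.Run α β (COS.stepSize b s) (COS.batchSize a s) (COS.compressionSize a b ζ s) P),
        R.CompressionErrorBound ε C ζ K →
        ∀ N : ℕ, 1 ≤ N →
          Integrable (R.errorAt ε C fs gs N) P ∧
          ∫ ω, R.errorAt ε C fs gs N ω ∂P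
            ≤ A * (Real.exp (-c * (N : ℝ) ^ ((b + 1) / (2 * a + 1)))
                + (N : ℝ) ^ (-(a / (2 * a + 1)))) ∧
          A * (Real.exp (-c * (N : ℝ) ^ ((b + 1) / (2 * a + 1)))
                + (N : ℝ) ^ (-(a / (2 * a + 1))))
            ≤ B * (N : ℝ) ^ (-(a / (2 * a + 1))) := by
  obtain ⟨κ, Λ, h⟩ := COS.exists_isRegularPlan hε hC hopt
  have ha : 0 < a := by linarith
  obtain ⟨A, hA, hle⟩ := COS.Run.exists_integral_errorAt_le hX hD h ha hb hb₀ hab hζ K s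
  obtain ⟨E, hE, hexp⟩ := COS.exists_exp_neg_rpow_le
    (div_pos (by linarith) (by linarith) : 0 < (b + 1) / (2 * a + 1)) (a / (2 * a + 1))
  refine ⟨1, one_pos, A, hA, A * (E + 1), by positivity, fun Ω _ P _ R hR N hN => ?_⟩
  obtain ⟨hint, hrate⟩ := hle Ω P R hR N hN
  refine ⟨hint, hrate.trans ?_, ?_⟩
  · gcongr
    exact le_add_of_nonneg_left (Real.exp_pos _).le
  · rw [mul_assoc, add_one_mul, neg_one_mul]
    gcongr
    exact hexp N (by exact_mod_cast hN)

/-- The offset `s` covers both usual numberings of the parameters: `η_t = t ^ b`, `b_t = t ^ (2a)`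
for `s = 0`, and `η_t = (t + 1) ^ b`, `b_t = (t + 1) ^ (2a)` for `s = 1`. The constants depend
neither on `N` nor on the run (probability space, samples, compression). -/
theorem theorem2 {d : ℕ} (𝒳 : Set (EuclideanSpace ℝ (Fin d))) (h𝒳 : IsCompact 𝒳)
    (α β : Measure 𝒳) [IsProbabilityMeasure α] [IsProbabilityMeasure β]
    (C : 𝒳 → 𝒳 → ℝ) (L : ℝ≥0) (hC : LipschitzWith L (Function.uncurry C))
    (ε : ℝ) (hε : 0 < ε)
    (fs gs : 𝒳 → ℝ) (hopt : COS.IsOptimalPotentials ε C α β fs gs)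
    (a b : ℝ) (hb : -1 < b) (hb' : b < -(1 / 2)) (hab : 1 < a - b)
    (ζ : ℝ) (hζ : 0 < ζ) (K : ℝ) (s : ℕ) :
    ∃ c : ℝ, 0 < c ∧ ∃ A : ℝ, 0 < A ∧ ∃ B : ℝ, 0 < B ∧
      ∀ (Ω : Type*) [MeasurableSpace Ω] (P : Measure Ω) [IsProbabilityMeasure P]
        (R : COS.Run α β (COS.stepSize b s) (COS.batchSize a s) (COS.compressionSize a b ζ s) P),
        R.CompressionErrorBound ε C ζ K →
        ∀ N : ℕ, 1 ≤ N →
          Integrable (R.errorAt ε C fs gs N) P ∧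
          ∫ ω, R.errorAt ε C fs gs N ω ∂P
            ≤ A * (Real.exp (-c * (N : ℝ) ^ ((b + 1) / (2 * a + 1)))
                + (N : ℝ) ^ (-(a / (2 * a + 1)))) ∧
          A * (Real.exp (-c * (N : ℝ) ^ ((b + 1) / (2 * a + 1)))
                + (N : ℝ) ^ (-(a / (2 * a + 1))))
            ≤ B * (N : ℝ) ^ (-(a / (2 * a + 1))) := by
  have := isCompact_iff_compactSpace.1 h𝒳
  obtain ⟨D, hD, hX⟩ := COS.exists_hasDyadicNets 𝒳 h𝒳.isBounded
  exact theorem2_general hX hD α β C L hC ε hε fs gs hopt a b hb (by linarith) hab ζ hζ K s
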